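/- Let $\mathbb H$ be the quaternions and $V$ a bilateral (two-sided) quaternionic Banach space (i.e. $(av)b=a(vb)$, $rv=vr$ for real $r$, and the norm satisfies $\|av\|=|a|\|v\|$, $\|va\|=\|v\||a|$ for $a,b\in\mathbb H$, $v\in V$). Let $\mathcal B(V)$ be the space of bounded right linear operators on $V$, with the operator norm and with $(aT)(v)=aT(v)$, $(Ta)(v)=T(av)$. For $T\in\mathcal B(V)$ let $$\sigma_S(T)=\{s\in\mathbb H : T^2-2\,\mathrm{Re}[s]\,T+|s|^2\mathcal I \text{ is not invertible in } \mathcal B(V)\},$$ $$S^{-1}(s,T)=-(T^2-2\,\mathrm{Re}[s]\,T+|s|^2\mathcal I)^{-1}(T-\overline s\,\mathcal I)\qquad (s\notin\sigma_S(T)).$$ A real differentiable function $f$ on an open set $\Omega\subseteq\mathbb H$ is (left) regular if $\frac12\left(\frac{\partial}{\partial x}+I\frac{\partial}{\partial y}\right)f(x+Iy)=0$ on $\Omega\cap(\mathbb R+I\mathbb R)$ for every imaginary unit $I$. Let $\mathcal R_{\sigma_S(T)}$ be the set of functions $f:\mathbb H\to\mathbb H$ that are regular on some ball $B(0,R)\supseteq\sigma_S(T)$.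 For $f\in\mathcal R_{\sigma_S(T)}$ put $$f(T)=\frac1{2\pi}\int_{\partial U}S^{-1}(s,T)\,ds_I\,f(s),\qquad ds_I=-I\,ds,$$ where $I$ is an imaginary unit and $U$ is a bounded open subset of $L_I=\mathbb R+I\mathbb R$ that contains $L_I\cap\sigma_S(T)$, whose closure lies in a ball $B(0,R)\supseteq\sigma_S(T)$ on which $f$ is regular, and whose positively oriented boundary consists of finitely many closed piecewise $C^1$ curves. Then such $I$ and $U$ exist for every $f\in\mathcal R_{\sigma_S(T)}$, and $f(T)$ does not depend on their choice. If $f,g\in\mathcal R_{\sigma_S(T)}$ and $\lambda\in\mathbb H$, then $f+g,\ f\lambda\in\mathcal R_{\sigma_S(T)}$ and $$(f+g)(T)=f(T)+g(T),\qquad (f\lambda)(T)=f(T)\lambda .$$ Moreover, if $\phi,\psi\in\mathcal R_{\sigma_S(T)}$ are given by power series $\phi(s)=\sum_{n\ge0}s^na_n$, $\psi(s)=\sum_{n\ge0}s^nb_n$ with $a_n,b_n\in\mathbb R$, each converging on a ball centered at $0$ that contains $\sigma_S(T)$, then $\phi\psi\in\mathcal R_{\sigma_S(T)}$ and $$(\phi\psi)(T)=\phi(T)\psi(T).$$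 -/

import Mathlib

open scoped Quaternion

noncomputable section

namespace QuaternionicCalculus

/-! ## Slices of the quaternions and slice regular functions -/

/-- The sphere of purely imaginary unit quaternions. -/
def imagSphere : Set ℍ[ℝ] := {I | I.re = 0 ∧ ‖I‖ = 1}

/-- The parametrization `x + iy ↦ x + Iy` of the plane `L_I = ℝ + Iℝ` by `ℂ`. -/
def slice (I : ℍ[ℝ]) (z : ℂ) : ℍ[ℝ] := (z.re : ℍ[ℝ]) + I * (z.im : ℍ[ℝ])

/-- `f` is left (slice) regular on the open set `Ω`: it is real differentiable there and
`½ (∂/∂x + I ∂/∂y) f(x + Iy) = 0` on `Ω ∩ L_I` for every imaginary unit `I`. -/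
def LeftRegularOn (f : ℍ[ℝ] → ℍ[ℝ]) (Ω : Set ℍ[ℝ]) : Prop :=
  DifferentiableOn ℝ f Ω ∧
    ∀ I ∈ imagSphere, ∀ x y : ℝ, (x : ℍ[ℝ]) + I * (y : ℍ[ℝ]) ∈ Ω →
      (1 / 2 : ℝ) • (deriv (fun u : ℝ => f ((u : ℍ[ℝ]) + I * (y : ℍ[ℝ]))) x
        + I * deriv (fun v : ℝ => f ((x : ℍ[ℝ]) + I * (v : ℍ[ℝ]))) y) = 0

/-! ## Bounded open subsets of a slice and their oriented boundary -/

/-- A closed piecewise continuously differentiable curve, parametrized by `[0, 1]`. -/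
def IsClosedPiecewiseC1 (γ : ℝ → ℂ) : Prop :=
  γ 0 = γ 1 ∧ ∃ (m : ℕ) (t : Fin (m + 1) → ℝ), Monotone t ∧ t 0 = 0 ∧ t (Fin.last m) = 1 ∧
    ∀ i : Fin m, ContDiffOn ℝ 1 γ (Set.Icc (t i.castSucc) (t i.succ))

/-- The winding number of the closed curve `γ` around a point `w` that is not on it. -/
def windingNumber (γ : ℝ → ℂ) (w : ℂ) : ℂ :=
  (2 * Real.pi * Complex.I)⁻¹ * ∫ t in (0 : ℝ)..1, deriv γ t / (γ t - w)

/-- A bounded open set `U` of a plane `L_I` (in the coordinates `x + iy ↔ x + Iy`), whose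
boundary consists of finitely many closed piecewise `C¹` curves, oriented positively with respect
to `U`: together they wind once around every point of `U` and do not wind around the points
outside the closure of `U`. -/
structure SliceDomain where
  /-- the imaginary unit of the plane -/
  I : ℍ[ℝ]
  I_mem : I ∈ imagSphere
  /-- the open set -/
  U : Set ℂ
  isOpen : IsOpen U
  isBounded : Bornology.IsBounded U
  /-- the number of boundary curves -/
  n : ℕ
  /-- the boundary curves -/
  γ : Fin n → ℝ → ℂ
  closed_curve : ∀ k, IsClosedPiecewiseC1 (γ k)
  image_eq : ⋃ k, γ k '' Set.Icc (0 : ℝ) 1 = frontier U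
  winding_inside : ∀ w ∈ U, ∑ k, windingNumber (γ k) w = 1
  winding_outside : ∀ w ∉ closure U, ∑ k, windingNumber (γ k) w = 0

/-! ## Bounded right linear operators on a bilateral quaternionic Banach space

The left action of `ℍ` on `V` is the action of `ℍ[ℝ]`, the right action `v q` is the action
`MulOpposite.op q • v` of the opposite ring. -/

section Operators

variable (V : Type*) [NormedAddCommGroup V] [NormedSpace ℝ V]
  [Module ℍ[ℝ] V] [IsBoundedSMul ℍ[ℝ] V] [IsScalarTower ℝ ℍ[ℝ] V]
  [Module ℍ[ℝ]ᵐᵒᵖ V] [IsBoundedSMul ℍ[ℝ]ᵐᵒᵖ V] [IsScalarTower ℝ ℍ[ℝ]ᵐᵒᵖ V]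
  [SMulCommClass ℍ[ℝ] ℍ[ℝ]ᵐᵒᵖ V]

/-- `𝓑(V)`: the bounded right linear operators on `V`, a real algebra under composition, with the
operator norm. -/
def BoundedOp : Subalgebra ℝ (V →L[ℝ] V) where
  carrier := {T | ∀ (q : ℍ[ℝ]) (v : V), T (MulOpposite.op q • v) = MulOpposite.op q • T v}
  mul_mem' := by
    intro S T hS hT q v
    simp [hS q, hT q]
  add_mem' := by
    intro S T hS hT q v
    simp [hS q, hT q]
  algebraMap_mem' := by
    intro r q v
    have h := (IsScalarTower.to_smulCommClass (R := ℝ) (A := ℍ[ℝ]ᵐᵒᵖ) (M := V)).smul_comm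
      r (MulOpposite.op q) v
    simpa [Algebra.algebraMap_eq_smul_one] using h

/-- `𝓑(V)` is a Banach space. -/
instance [CompleteSpace V] : CompleteSpace (BoundedOp V) := by
  have hc : IsClosed ((BoundedOp V : Set (V →L[ℝ] V))) := by
    have : (BoundedOp V : Set (V →L[ℝ] V)) = ⋂ (q : ℍ[ℝ]) (v : V),
        {T | T (MulOpposite.op q • v) = MulOpposite.op q • T v} := by
      ext T
      simp [BoundedOp]
    rw [this]
    refine isClosed_iInter fun q => isClosed_iInter fun v => ?_
    exact isClosed_eq (ContinuousLinearMap.apply ℝ V (MulOpposite.op q • v)).continuous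
      ((ContinuousLinearMap.apply ℝ V v).continuous.const_smul _)
  exact hc.completeSpace_coe

variable {V}

/-- The operator `a𝓘 : v ↦ a v`. The products of the bilateral space `𝓑(V)` are
`a T = leftMul a * T` and `T a = T * leftMul a`, so that `(a T)(v) = a (T v)` and
`(T a)(v) = T (a v)`. -/
def leftMul (a : ℍ[ℝ]) : BoundedOp V :=
  ⟨{ toFun := fun v => a • v
     map_add' := smul_add a
     map_smul' := fun r v =>
      ((IsScalarTower.to_smulCommClass (R := ℝ) (A := ℍ[ℝ]) (M := V)).smul_comm r a v).symm
     cont := continuous_const_smul a },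
    fun q v => smul_comm a (MulOpposite.op q) v⟩

/-- `T² - 2 Re[s] T + |s|² 𝓘`. -/
def sPolynomial (s : ℍ[ℝ]) (T : BoundedOp V) : BoundedOp V :=
  T ^ 2 - (2 * s.re) • T + (‖s‖ ^ 2) • (1 : BoundedOp V)

/-- The `S`-spectrum. -/
def sSpectrum (T : BoundedOp V) : Set ℍ[ℝ] := {s | ¬ IsUnit (sPolynomial s T)}

/-- The `S`-resolvent operator `-(T² - 2 Re[s] T + |s|² 𝓘)⁻¹ (T - s̄ 𝓘)`, for `s` outside the
`S`-spectrum. -/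
def sResolvent (s : ℍ[ℝ]) (T : BoundedOp V) : BoundedOp V :=
  -(Ring.inverse (sPolynomial s T) * (T - leftMul (star s)))

/-- The functions that are locally regular on `σ_S(T)`: regular on some ball `B(0, R)` that
contains `σ_S(T)`. -/
def locallyRegular (T : BoundedOp V) : Set (ℍ[ℝ] → ℍ[ℝ]) :=
  {f | ∃ R : ℝ, 0 < R ∧ sSpectrum T ⊆ Metric.ball 0 R ∧ LeftRegularOn f (Metric.ball 0 R)}

/-- `D = (I, U)` can be used to compute `f(T)`: `U` contains `L_I ∩ σ_S(T)`, and its closure lies in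
a ball around the origin that contains `σ_S(T)` and on which `f` is regular. -/
def SliceDomain.Admissible (D : SliceDomain) (T : BoundedOp V) (f : ℍ[ℝ] → ℍ[ℝ]) : Prop :=
  (∀ z : ℂ, slice D.I z ∈ sSpectrum T → z ∈ D.U) ∧
    ∃ R : ℝ, 0 < R ∧ sSpectrum T ⊆ Metric.ball 0 R ∧ LeftRegularOn f (Metric.ball 0 R) ∧
      ∀ z ∈ closure D.U, slice D.I z ∈ Metric.ball (0 : ℍ[ℝ]) R

/-- `(1 / 2π) ∫_{∂U} S⁻¹(s, T) ds_I f(s)` with `ds_I = -I ds`. -/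
def SliceDomain.cauchyIntegral (D : SliceDomain) (T : BoundedOp V) (f : ℍ[ℝ] → ℍ[ℝ]) :
    BoundedOp V :=
  (1 / (2 * Real.pi)) • ∑ k, ∫ t in (0 : ℝ)..1,
    sResolvent (slice D.I (D.γ k t)) T * leftMul (-D.I * slice D.I (deriv (D.γ k) t)) *
      leftMul (f (slice D.I (D.γ k t)))

open Classical in
/-- `f(T)`, computed with any choice of `I` and `U`. -/
def funCalc (T : BoundedOp V) (f : ℍ[ℝ] → ℍ[ℝ]) : BoundedOp V :=
  if h : ∃ D : SliceDomain, D.Admissible T f then h.choose.cauchyIntegral T f else 0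

/-- `φ(s) = ∑ sⁿ aₙ` with real coefficients `aₙ`, on a ball `B(0, R)` that contains `σ_S(T)`. -/
def IsRealPowerSeriesNear (T : BoundedOp V) (φ : ℍ[ℝ] → ℍ[ℝ]) : Prop :=
  ∃ (a : ℕ → ℝ) (R : ℝ), 0 < R ∧ sSpectrum T ⊆ Metric.ball 0 R ∧
    ∀ s ∈ Metric.ball (0 : ℍ[ℝ]) R, HasSum (fun n : ℕ => s ^ n * (a n : ℍ[ℝ])) (φ s)

end Operators

end QuaternionicCalculus

end

open QuaternionicCalculus

open scoped Quaternion

noncomputable section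

namespace QuaternionicCalculus

open Set Filter Topology MeasureTheory

set_option linter.unusedSectionVars false

/-! ## Interval integrals in Banach algebras -/

section Integral

variable {A : Type*} [NormedRing A] [NormedAlgebra ℝ A] [CompleteSpace A] {g : ℝ → A} {a b : ℝ}

/-! A regular function on a ball around 0 is a power series `∑ sᵐ aₘ`, and everything rests on the
formula `f(T) = ∑ Tᵐ aₘ`. Its right side mentions neither `I` nor `U`, so independence of these
choices follows. Additivity and right homogeneity are read off termwise, and the product rule is the
Cauchy product of two absolutely convergent series whose real coefficients commute with `T`.

The formula is reduced to complex spectral theory. Fix `I` and let `ℂ ≅ L_I` act on `𝓑(V)` by right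
multiplication. Left multiplication by `T` is then a complex linear operator `a`, and the vector `(z
- a)⁻¹ 1` is exactly the `S`-resolvent at `x + Iy` (`ContractiveRep.resolvent_mulLeft`). Applying
the identity `∑ ∫ zᵐ (z - a)⁻¹ dz = 2πi aᵐ` (`sum_integral_pow_smul_resolvent`) to the vector 1
gives the Cauchy integral of `sᵐ`.

The same integrals bound `‖Tᵐ‖` by `C ρᵐ` with `ρ` below the radius of convergence, so the series
converges absolutely; dominated convergence lets it be integrated termwise
(`hasSum_cauchyIntegral`). On the side of `f`, regularity on one slice is holomorphy of a map into a
complex Banach space, and the Taylor coefficients on different slices agree because all slices share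
the real axis (`LeftRegularOn.exists_series`). -/

theorem integral_const_mul_of_intervalIntegrable (hg : IntervalIntegrable g volume a b) (r : A) :
    ∫ t in a..b, r * g t = r * ∫ t in a..b, g t :=
  (ContinuousLinearMap.mul ℝ A r).intervalIntegral_comp_comm hg

theorem integral_mul_const_of_intervalIntegrable (hg : IntervalIntegrable g volume a b) (r : A) :
    ∫ t in a..b, g t * r = (∫ t in a..b, g t) * r :=
  ((ContinuousLinearMap.mul ℝ A).flip r).intervalIntegral_comp_comm hg

end Integral

/-! ## Closed piecewise `C¹` curves -/

namespace IsClosedPiecewiseC1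

variable {γ : ℝ → ℂ}

theorem exists_mem_Ioc {m : ℕ} (t : Fin (m + 1) → ℝ) (j : Fin (m + 1)) (x : ℝ) (h0 : t 0 < x)
    (hj : x ≤ t j) : ∃ i : Fin m, x ∈ Ioc (t i.castSucc) (t i.succ) := by
  induction j using Fin.induction with
  | zero => exact absurd hj (not_le.2 h0)
  | succ i ih =>
    rcases le_or_gt x (t i.castSucc) with h | h
    · exact ih h
    · exact ⟨i, h, hj⟩

theorem continuousOn (h : IsClosedPiecewiseC1 γ) : ContinuousOn γ (Icc 0 1) := by
  obtain ⟨-, m, t, ht, h0, h1, hC⟩ := h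
  have := LocallyFinite.continuousOn_iUnion
    (locallyFinite_of_finite fun i : Fin m => Icc (t i.castSucc) (t i.succ))
    (fun i => isClosed_Icc) (fun i => (hC i).continuousOn)
  refine this.mono fun x hx => ?_
  rw [mem_iUnion]
  rcases hx.1.eq_or_lt with rfl | hx0
  · obtain ⟨i, hi⟩ := exists_mem_Ioc t (Fin.last m) 1 (by rw [h0]; exact one_pos) h1.ge
    have hm : 0 < m := i.pos
    refine ⟨⟨0, hm⟩, ?_, ?_⟩
    · exact (congrArg t (by ext; simp)).trans h0 |>.le
    · rw [← h0]; exact ht (Fin.zero_le _)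
  · obtain ⟨i, hi⟩ := exists_mem_Ioc t (Fin.last m) x (by rwa [h0]) (by rw [h1]; exact hx.2)
    exact ⟨i, Ioc_subset_Icc_self hi⟩

/-- Inside each piece `deriv γ` is the one-sided derivative, which is continuous on the compact
piece and hence bounded. The knots, where `γ` may have corners, form the exceptional set; since `t`
is only monotone, pieces may degenerate to points. -/
theorem exists_bound_deriv (h : IsClosedPiecewiseC1 γ) : ∃ (s : Set ℝ) (C : ℝ), s.Countable ∧
    ∀ x ∈ Icc (0 : ℝ) 1 \ s, DifferentiableAt ℝ γ x ∧ ‖deriv γ x‖ ≤ C := by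
  obtain ⟨-, m, t, ht, h0, h1, hC⟩ := h
  have hb : ∀ i : Fin m, ∃ C, ∀ x ∈ Ioo (t i.castSucc) (t i.succ),
      DifferentiableAt ℝ γ x ∧ ‖deriv γ x‖ ≤ C := by
    intro i
    by_cases hlt : t i.castSucc < t i.succ
    · have hc := (hC i).continuousOn_derivWithin (uniqueDiffOn_Icc hlt) le_rfl
      obtain ⟨C, hC'⟩ := isCompact_Icc.exists_bound_of_continuousOn hc
      refine ⟨C, fun x hx => ?_⟩
      have hn : Icc (t i.castSucc) (t i.succ) ∈ 𝓝 x := Icc_mem_nhds hx.1 hx.2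
      have hd := ((hC i).differentiableOn (by norm_num) x
        (Ioo_subset_Icc_self hx)).differentiableAt hn
      refine ⟨hd, ?_⟩
      rw [← derivWithin_of_mem_nhds hn]
      exact hC' x (Ioo_subset_Icc_self hx)
    · exact ⟨0, fun x hx => absurd (hx.1.trans hx.2) hlt⟩
  choose C hC' using hb
  refine ⟨range t, ∑ i, |C i|, (finite_range t).countable, fun x hx => ?_⟩
  have hx0 : t 0 < x := by
    rcases hx.1.1.eq_or_lt with h | h
    · exact absurd ⟨0, h0.trans h⟩ hx.2
    · rwa [h0]
  obtain ⟨i, hi⟩ := exists_mem_Ioc t (Fin.last m) x hx0 (by rw [h1]; exact hx.1.2)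
  have hi' : x ∈ Ioo (t i.castSucc) (t i.succ) :=
    ⟨hi.1, hi.2.lt_of_ne fun e => hx.2 ⟨_, e.symm⟩⟩
  refine ⟨(hC' i x hi').1, (hC' i x hi').2.trans ((le_abs_self _).trans ?_)⟩
  exact Finset.single_le_sum (f := fun i => |C i|) (fun _ _ => abs_nonneg _) (Finset.mem_univ i)

theorem exists_ae_bound_deriv (h : IsClosedPiecewiseC1 γ) :
    ∃ C : ℝ, 0 ≤ C ∧ ∀ᵐ x, x ∈ uIoc (0 : ℝ) 1 → ‖deriv γ x‖ ≤ C := by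
  obtain ⟨s, C, hs, hC⟩ := h.exists_bound_deriv
  refine ⟨|C|, abs_nonneg _, ?_⟩
  filter_upwards [hs.ae_notMem volume] with x hx hx'
  rw [uIoc_of_le zero_le_one] at hx'
  exact (hC x ⟨Ioc_subset_Icc_self hx', hx⟩).2.trans (le_abs_self C)

theorem intervalIntegrable_deriv (h : IsClosedPiecewiseC1 γ) :
    IntervalIntegrable (deriv γ) volume 0 1 := by
  obtain ⟨C, -, hC⟩ := h.exists_ae_bound_deriv
  rw [intervalIntegrable_iff]
  refine Measure.integrableOn_of_bounded (M := C) (by simp)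
    (measurable_deriv γ).aestronglyMeasurable ?_
  rwa [ae_restrict_iff' measurableSet_uIoc]

theorem intervalIntegrable_deriv_smul {E : Type*} [NormedAddCommGroup E] [NormedSpace ℂ E]
    (h : IsClosedPiecewiseC1 γ) {H : ℝ → E} (hH : ContinuousOn H (Icc 0 1)) :
    IntervalIntegrable (fun t => deriv γ t • H t) volume 0 1 :=
  h.intervalIntegrable_deriv.smul_continuousOn (by rwa [uIcc_of_le zero_le_one])

/-- The power has the primitive `z ^ (m + 1) / (m + 1)`, which takes equal values at both ends of a
closed curve. -/
theorem integral_deriv_mul_pow (h : IsClosedPiecewiseC1 γ) (m : ℕ) :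
    ∫ t in (0 : ℝ)..1, deriv γ t * γ t ^ m = 0 := by
  obtain ⟨s, C, hs, hC⟩ := h.exists_bound_deriv
  have hc := h.continuousOn
  have hm : (m + 1 : ℂ) ≠ 0 := by exact_mod_cast m.succ_ne_zero
  have := integral_eq_of_hasDerivAt_off_countable_of_le
    (fun t => (m + 1 : ℂ)⁻¹ * γ t ^ (m + 1)) (fun t => deriv γ t * γ t ^ m) zero_le_one hs
    (continuousOn_const.mul (hc.pow _)) (fun x hx => ?_)
    (h.intervalIntegrable_deriv_smul (hc.pow m))
  · rw [this, h.1, sub_self]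
  · have hd := (hC x ⟨Ioo_subset_Icc_self hx.1, hx.2⟩).1.hasDerivAt
    have := (hd.pow (m + 1)).const_mul (m + 1 : ℂ)⁻¹
    refine HasDerivAt.congr_deriv this ?_
    push_cast
    field_simp

end IsClosedPiecewiseC1

/-! ## The Cauchy integral of the resolvent over a cycle that winds once around the spectrum -/

section Cycle

variable {E : Type*} [NormedAddCommGroup E] [NormedSpace ℂ E]

/-- Differentiation under the integral sign: the curve avoids `U`, so the kernel and its derivative
stay bounded for `w` in half of a ball around `z` that lies in `U`. -/
theorem differentiableAt_cauchyTransform {γ : ℝ → ℂ}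
    (h : IsClosedPiecewiseC1 γ) {H : ℝ → E} (hH : ContinuousOn H (Icc 0 1)) {U : Set ℂ}
    (hU : IsOpen U) (hγU : ∀ t ∈ Icc (0 : ℝ) 1, γ t ∉ U) {z : ℂ} (hz : z ∈ U) :
    DifferentiableAt ℂ (fun w => ∫ t in (0 : ℝ)..1, deriv γ t • ((γ t - w)⁻¹ • H t)) z := by
  obtain ⟨δ, hδ, hδU⟩ := Metric.isOpen_iff.1 hU z hz
  have hfar : ∀ w ∈ Metric.ball z (δ / 2), ∀ t ∈ Icc (0 : ℝ) 1, δ / 2 ≤ ‖γ t - w‖ := by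
    intro w hw t ht
    by_contra! hlt
    refine hγU t ht (hδU ?_)
    rw [Metric.mem_ball] at hw ⊢
    rw [← dist_eq_norm] at hlt
    linarith [dist_triangle (γ t) w z]
  have hne : ∀ w ∈ Metric.ball z (δ / 2), ∀ t ∈ Icc (0 : ℝ) 1, γ t - w ≠ 0 := by
    intro w hw t ht
    rw [← norm_pos_iff]
    linarith [hfar w hw t ht]
  have hzz : z ∈ Metric.ball z (δ / 2) := Metric.mem_ball_self (by positivity)
  have hinv : ∀ w ∈ Metric.ball z (δ / 2), ContinuousOn (fun t => (γ t - w)⁻¹) (Icc 0 1) :=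
    fun w hw => (h.continuousOn.sub continuousOn_const).inv₀ (hne w hw)
  obtain ⟨C, hC0, hC⟩ := h.exists_ae_bound_deriv
  obtain ⟨K, hK⟩ := isCompact_Icc.exists_bound_of_continuousOn hH
  have hIcc : uIoc (0 : ℝ) 1 ⊆ Icc 0 1 := by
    rw [uIoc_of_le zero_le_one]; exact Ioc_subset_Icc_self
  refine (intervalIntegral.hasDerivAt_integral_of_dominated_loc_of_deriv_le
    (F' := fun w t => deriv γ t • (((γ t - w)⁻¹ ^ 2) • H t))
    (bound := fun _ => C * (((δ / 2)⁻¹ ^ 2) * K))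
    (Metric.ball_mem_nhds z (half_pos hδ)) ?_ ?_ ?_ ?_ ?_ ?_).2.differentiableAt
  · filter_upwards [Metric.ball_mem_nhds z (half_pos hδ)] with w hw
    exact (intervalIntegrable_iff.1
      (h.intervalIntegrable_deriv_smul ((hinv w hw).smul hH))).aestronglyMeasurable
  · exact h.intervalIntegrable_deriv_smul ((hinv z hzz).smul hH)
  · exact (intervalIntegrable_iff.1 (h.intervalIntegrable_deriv_smul
      (((hinv z hzz).pow 2).smul hH))).aestronglyMeasurable
  · filter_upwards [hC] with t ht htI w hw
    rw [norm_smul, norm_smul, norm_pow, norm_inv]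
    have h1 := hfar w hw t (hIcc htI)
    have h2 := hK t (hIcc htI)
    have h3 := ht htI
    gcongr
  · exact intervalIntegrable_const
  · filter_upwards with t htI w hw
    have h1 : HasDerivAt (fun w => (γ t - w)⁻¹) ((γ t - w)⁻¹ ^ 2) w := by
      have := ((hasDerivAt_id w).const_sub (γ t)).inv (hne w hw t (hIcc htI))
      exact HasDerivAt.congr_deriv this (by simp)
    exact (h1.smul_const (H t)).const_smul _

variable {B : Type*} [NormedRing B] [NormedAlgebra ℂ B]

theorem resolvent_sub_resolvent_eq {a : B} {w z : ℂ} (hw : w ∈ resolventSet ℂ a)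
    (hz : z ∈ resolventSet ℂ a) :
    resolvent a w - resolvent a z = (z - w) • (resolvent a w * resolvent a z) := by
  have h1 : resolvent a w * (algebraMap ℂ B w - a) = 1 := Ring.inverse_mul_cancel _ hw
  have h2 : (algebraMap ℂ B z - a) * resolvent a z = 1 := Ring.mul_inverse_cancel _ hz
  calc resolvent a w - resolvent a z
      = resolvent a w * ((algebraMap ℂ B z - a) * resolvent a z)
        - (resolvent a w * (algebraMap ℂ B w - a)) * resolvent a z := by rw [h1, h2]; simp
    _ = resolvent a w * (algebraMap ℂ B (z - w)) * resolvent a z := by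
        rw [map_sub]; noncomm_ring
    _ = _ := by
        rw [← Algebra.commutes, ← Algebra.smul_def, smul_mul_assoc]

variable [CompleteSpace B]

theorem continuousOn_resolvent (a : B) : ContinuousOn (resolvent a) (resolventSet ℂ a) :=
  fun _ hz => (spectrum.hasDerivAt_resolvent_const_left hz).continuousAt.continuousWithinAt

variable {n : ℕ} {γ : Fin n → ℝ → ℂ} {U : Set ℂ} {a : B}

theorem continuousOn_resolvent_comp {γ : ℝ → ℂ} (h : IsClosedPiecewiseC1 γ)
    (hγU : ∀ t ∈ Icc (0 : ℝ) 1, γ t ∉ U) (ha : spectrum ℂ a ⊆ U) :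
    ContinuousOn (fun t => resolvent a (γ t)) (Icc 0 1) :=
  (continuousOn_resolvent a).comp h.continuousOn fun t ht => by
    by_contra hc
    exact hγU t ht (ha hc)

/-- A Liouville argument in the style of Dixon's proof of Cauchy's theorem. Write `c = 2πi`, let `P`
be the left side and `G` the Cauchy transform of the resolvent. Where `U` meets the resolvent set,
the resolvent identity and winding number 1 give `G z = (c - P) (z - a)⁻¹`. So `G` on `U` and the
right side off the spectrum glue to an entire function that vanishes at infinity, hence everywhere.
Far out the resolvent is invertible, which forces `P = c`. -/
theorem sum_integral_resolvent (hγ : ∀ k, IsClosedPiecewiseC1 (γ k)) (hU : IsOpen U)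
    (hUb : Bornology.IsBounded U) (hγU : ∀ k, ∀ t ∈ Icc (0 : ℝ) 1, γ k t ∉ U)
    (hwind : ∀ w ∈ U, ∑ k, windingNumber (γ k) w = 1) (ha : spectrum ℂ a ⊆ U) :
    ∑ k, ∫ t in (0 : ℝ)..1, deriv (γ k) t • resolvent a (γ k t)
      = (2 * Real.pi * Complex.I : ℂ) • (1 : B) := by
  classical
  set P : B := ∑ k, ∫ t in (0 : ℝ)..1, deriv (γ k) t • resolvent a (γ k t) with hP
  set c : ℂ := 2 * Real.pi * Complex.I with hc
  have hc0 : c ≠ 0 := by simp [hc, Real.pi_ne_zero]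
  have hRc := fun k => continuousOn_resolvent_comp (hγ k) (hγU k) ha
  have hmem : ∀ k, ∀ t ∈ Icc (0 : ℝ) 1, γ k t ∈ resolventSet ℂ a := fun k t ht => by
    by_contra hc
    exact hγU k t ht (ha hc)
  set G : ℂ → B := fun w => ∑ k, ∫ t in (0 : ℝ)..1,
    deriv (γ k) t • ((γ k t - w)⁻¹ • resolvent a (γ k t)) with hG
  have hGd : ∀ z ∈ U, DifferentiableAt ℂ G z := fun z hz =>
    DifferentiableAt.fun_sum fun k _ =>
      differentiableAt_cauchyTransform (hγ k) (hRc k) hU (hγU k) hz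
  have hGeq : ∀ z ∈ U, z ∈ resolventSet ℂ a → G z = (c • 1 - P) * resolvent a z := by
    intro z hz hzr
    have key : ∀ k, ∫ t in (0 : ℝ)..1, deriv (γ k) t • ((γ k t - z)⁻¹ • resolvent a (γ k t))
        = (c * windingNumber (γ k) z) • resolvent a z
          - (∫ t in (0 : ℝ)..1, deriv (γ k) t • resolvent a (γ k t)) * resolvent a z := by
      intro k
      have hne : ∀ t ∈ Icc (0 : ℝ) 1, γ k t - z ≠ 0 := fun t ht h =>
        hγU k t ht (by rwa [sub_eq_zero.1 h])
      have hinv : ContinuousOn (fun t => (γ k t - z)⁻¹) (Icc 0 1) :=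
        ((hγ k).continuousOn.sub continuousOn_const).inv₀ hne
      have e1 : (c * windingNumber (γ k) z) • resolvent a z
          = ∫ t in (0 : ℝ)..1, deriv (γ k) t • ((γ k t - z)⁻¹ • resolvent a z) := by
        rw [windingNumber, mul_inv_cancel_left₀ hc0, ← intervalIntegral.integral_smul_const]
        exact intervalIntegral.integral_congr fun t _ => by rw [div_eq_mul_inv, mul_smul]
      have e2 : (∫ t in (0 : ℝ)..1, deriv (γ k) t • resolvent a (γ k t)) * resolvent a z
          = ∫ t in (0 : ℝ)..1, deriv (γ k) t • (resolvent a (γ k t) * resolvent a z) := by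
        refine (integral_mul_const_of_intervalIntegrable
          ((hγ k).intervalIntegrable_deriv_smul (hRc k)) _).symm.trans ?_
        exact intervalIntegral.integral_congr fun t _ => smul_mul_assoc _ _ _
      rw [e1, e2, ← intervalIntegral.integral_sub]
      · refine intervalIntegral.integral_congr fun t ht => ?_
        rw [uIcc_of_le zero_le_one] at ht
        rw [← smul_sub, ← sub_eq_zero, ← smul_sub]
        have := resolvent_sub_resolvent_eq (hmem k t ht) hzr
        rw [sub_sub_eq_add_sub, add_sub_right_comm, ← smul_sub, this, smul_smul,
          ← neg_sub (γ k t) z, mul_neg, inv_mul_cancel₀ (hne t ht)]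
        simp
      · exact (hγ k).intervalIntegrable_deriv_smul (hinv.smul continuousOn_const)
      · exact (hγ k).intervalIntegrable_deriv_smul ((hRc k).mul continuousOn_const)
    simp only [hG]
    rw [Finset.sum_congr rfl fun k _ => key k, Finset.sum_sub_distrib, ← Finset.sum_smul,
      ← Finset.mul_sum, hwind z hz, ← Finset.sum_mul, sub_mul, mul_one, smul_mul_assoc, one_mul]
  -- The spectrum lies in `U`, so the second branch is only used on the resolvent set.
  set F : ℂ → B := fun z => if z ∈ U then G z else (c • 1 - P) * resolvent a z with hF
  have hFout : ∀ z ∈ resolventSet ℂ a, F z = (c • 1 - P) * resolvent a z := by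
    intro z hz
    by_cases hzU : z ∈ U
    · simp only [hF, if_pos hzU, hGeq z hzU hz]
    · simp only [hF, if_neg hzU]
  have hFd : Differentiable ℂ F := by
    intro z
    by_cases hzU : z ∈ U
    · refine (hGd z hzU).congr_of_eventuallyEq ?_
      filter_upwards [hU.mem_nhds hzU] with w hw
      simp only [hF, if_pos hw]
    · have hz : z ∈ resolventSet ℂ a := by
        by_contra h
        exact hzU (ha h)
      refine ((spectrum.hasDerivAt_resolvent_const_left hz).differentiableAt.const_mul
        (c • 1 - P)).congr_of_eventuallyEq ?_
      filter_upwards [(spectrum.isOpen_resolventSet a).mem_nhds hz] with w hw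
      exact hFout w hw
  have hev : ∀ᶠ z in Bornology.cobounded ℂ, z ∉ U := by
    exact hUb
  have hF0 : ∀ z, F z = 0 := by
    intro z
    refine hFd.apply_eq_of_tendsto_cocompact z ?_
    rw [← Metric.cobounded_eq_cocompact]
    have := (spectrum.resolvent_tendsto_cobounded (𝕜 := ℂ) a).const_mul (c • 1 - P)
    rw [mul_zero] at this
    refine this.congr' ?_
    filter_upwards [hev] with w hw
    simp only [hF, if_neg hw]
  obtain ⟨z, hzU, hzu⟩ := (hev.and (spectrum.eventually_isUnit_resolvent (𝕜 := ℂ) a)).exists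
  have h0 := hF0 z
  simp only [hF, if_neg hzU] at h0
  rw [hzu.mul_left_eq_zero] at h0
  exact (sub_eq_zero.1 h0).symm

/-- Induction through `z (z - a)⁻¹ = 1 + a (z - a)⁻¹`: the extra term `zᵐ · 1` integrates to zero
over closed curves. -/
theorem sum_integral_pow_smul_resolvent (hγ : ∀ k, IsClosedPiecewiseC1 (γ k)) (hU : IsOpen U)
    (hUb : Bornology.IsBounded U) (hγU : ∀ k, ∀ t ∈ Icc (0 : ℝ) 1, γ k t ∉ U)
    (hwind : ∀ w ∈ U, ∑ k, windingNumber (γ k) w = 1) (ha : spectrum ℂ a ⊆ U) (m : ℕ) :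
    ∑ k, ∫ t in (0 : ℝ)..1, deriv (γ k) t • (γ k t ^ m • resolvent a (γ k t))
      = (2 * Real.pi * Complex.I : ℂ) • a ^ m := by
  induction m with
  | zero => simpa using sum_integral_resolvent hγ hU hUb hγU hwind ha
  | succ m ih =>
    have key : ∀ k, ∫ t in (0 : ℝ)..1, deriv (γ k) t • (γ k t ^ (m + 1) • resolvent a (γ k t))
        = a * ∫ t in (0 : ℝ)..1, deriv (γ k) t • (γ k t ^ m • resolvent a (γ k t)) := by
      intro k
      have hc := (hγ k).continuousOn
      have e1 : ∫ t in (0 : ℝ)..1, deriv (γ k) t • (γ k t ^ m • (1 : B)) = 0 := by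
        have := intervalIntegral.integral_smul_const (μ := volume) (a := 0) (b := 1)
          (fun t => deriv (γ k) t * γ k t ^ m) (1 : B)
        rw [(hγ k).integral_deriv_mul_pow m, zero_smul] at this
        simpa only [mul_smul] using this
      refine Eq.trans ?_ (integral_const_mul_of_intervalIntegrable
        ((hγ k).intervalIntegrable_deriv_smul
          ((hc.pow m).smul (continuousOn_resolvent_comp (hγ k) (hγU k) ha))) a)
      rw [← zero_add (∫ t in (0 : ℝ)..1, a * _), ← e1, ← intervalIntegral.integral_add]
      · refine intervalIntegral.integral_congr fun t ht => ?_
        rw [uIcc_of_le zero_le_one] at ht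
        have hr : γ k t ∈ resolventSet ℂ a := by
          by_contra h
          exact hγU k t ht (ha h)
        have h2 : (algebraMap ℂ B (γ k t) - a) * resolvent a (γ k t) = 1 :=
          Ring.mul_inverse_cancel _ hr
        rw [sub_mul, ← Algebra.smul_def, sub_eq_iff_eq_add] at h2
        simp only [pow_succ, mul_smul, h2, mul_smul_comm, smul_add, Pi.smul_apply', Pi.pow_apply]
      · exact (hγ k).intervalIntegrable_deriv_smul ((hc.pow m).smul continuousOn_const)
      · exact ((hγ k).intervalIntegrable_deriv_smul ((hc.pow m).smul
          (continuousOn_resolvent_comp (hγ k) (hγU k) ha))).const_mul a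
    rw [Finset.sum_congr rfl fun k _ => key k, ← Finset.mul_sum, ih, mul_smul_comm, pow_succ']

end Cycle

/-! ## Contractive representations of `ℂ` and the complex structure they define -/

/-- A contractive homomorphism of real algebras from `ℂ`. -/
structure ContractiveRep (A : Type*) [NormedRing A] [NormedAlgebra ℝ A] where
  /-- the homomorphism -/
  hom : ℂ →ₐ[ℝ] A
  norm_le : ∀ z, ‖hom z‖ ≤ ‖z‖

namespace ContractiveRep

variable {A : Type*} [NormedRing A] [NormedAlgebra ℝ A] (φ : ContractiveRep A)

/-- The algebra `A` as a complex vector space, with `z • X = X * φ z`. -/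
def RightModule (_ : ContractiveRep A) : Type _ := A

instance : NormedAddCommGroup φ.RightModule := inferInstanceAs (NormedAddCommGroup A)

instance [CompleteSpace A] : CompleteSpace φ.RightModule := inferInstanceAs (CompleteSpace A)

/-- The identification of the complex vector space with `A`. -/
def toAlgebra : φ.RightModule ≃+ A := AddEquiv.refl A

theorem continuous_toAlgebra : Continuous φ.toAlgebra := continuous_id

theorem norm_toAlgebra (X : φ.RightModule) : ‖φ.toAlgebra X‖ = ‖X‖ := rfl

instance : SMul ℂ φ.RightModule := ⟨fun z X => φ.toAlgebra.symm (φ.toAlgebra X * φ.hom z)⟩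

theorem toAlgebra_smul (z : ℂ) (X : φ.RightModule) :
    φ.toAlgebra (z • X) = φ.toAlgebra X * φ.hom z := rfl

instance : Module ℂ φ.RightModule where
  one_smul X := φ.toAlgebra.injective (by simp [toAlgebra_smul])
  mul_smul z w X := φ.toAlgebra.injective (by
    simp [toAlgebra_smul, mul_comm z w, mul_assoc])
  smul_zero z := φ.toAlgebra.injective (by simp [toAlgebra_smul])
  smul_add z X Y := φ.toAlgebra.injective (by simp [toAlgebra_smul, add_mul])
  add_smul z w X := φ.toAlgebra.injective (by simp [toAlgebra_smul, mul_add])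
  zero_smul X := φ.toAlgebra.injective (by simp [toAlgebra_smul])

instance : NormedSpace ℂ φ.RightModule where
  norm_smul_le z X := by
    rw [← norm_toAlgebra, toAlgebra_smul, mul_comm, ← norm_toAlgebra]
    exact (norm_mul_le _ _).trans (by gcongr; exact φ.norm_le z)

/-- Left multiplication is complex linear. -/
def mulLeft (T : A) : φ.RightModule →L[ℂ] φ.RightModule :=
  LinearMap.mkContinuous
    { toFun := fun X => φ.toAlgebra.symm (T * φ.toAlgebra X)
      map_add' := fun X Y => φ.toAlgebra.injective (by simp [mul_add])
      map_smul' := fun z X => φ.toAlgebra.injective (by simp [toAlgebra_smul, mul_assoc]) }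
    ‖T‖ fun X => norm_mul_le T (φ.toAlgebra X)

theorem toAlgebra_mulLeft (T : A) (X : φ.RightModule) :
    φ.toAlgebra (φ.mulLeft T X) = T * φ.toAlgebra X := rfl

theorem toAlgebra_mulLeft_pow (T : A) (m : ℕ) (X : φ.RightModule) :
    φ.toAlgebra ((φ.mulLeft T ^ m) X) = T ^ m * φ.toAlgebra X := by
  induction m with
  | zero => simp
  | succ m ih => rw [pow_succ', ContinuousLinearMap.mul_def, ContinuousLinearMap.comp_apply,
      toAlgebra_mulLeft, ih, pow_succ', mul_assoc]

theorem hom_add_hom_conj (z : ℂ) :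
    φ.hom z + φ.hom (starRingEnd ℂ z) = (2 * z.re) • (1 : A) := by
  rw [← map_add, Complex.add_conj, ← Complex.coe_algebraMap, φ.hom.commutes,
    Algebra.algebraMap_eq_smul_one]

theorem hom_conj_mul_hom (z : ℂ) :
    φ.hom (starRingEnd ℂ z) * φ.hom z = (‖z‖ ^ 2) • (1 : A) := by
  rw [← map_mul, mul_comm, Complex.mul_conj, Complex.normSq_eq_norm_sq,
    ← Complex.coe_algebraMap, φ.hom.commutes, Algebra.algebraMap_eq_smul_one]

/-- `T² - 2 Re[z] T + |z|²`. -/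
def quadratic (T : A) (z : ℂ) : A := T ^ 2 - (2 * z.re) • T + (‖z‖ ^ 2) • (1 : A)

/-- `-(T² - 2 Re[z] T + |z|²)⁻¹ (T - z̄)`. -/
def sResolvent (T : A) (z : ℂ) : A :=
  -(Ring.inverse (quadratic T z) * (T - φ.hom (starRingEnd ℂ z)))

theorem commute_quadratic (T : A) (z : ℂ) : Commute T (quadratic T z) := by
  unfold quadratic
  exact (((Commute.refl T).pow_right 2).sub_right ((Commute.refl T).smul_right _)).add_right
    ((Commute.one_right T).smul_right _)

/-- With scalars acting on the right, `z` commutes with `a`, and `(a - z̄)(a - z)` is left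
multiplication by `T² - 2 Re[z] T + |z|²`, because `z + z̄` and `z z̄` are real and so central.
Hence `(z - a)⁻¹` is minus the inverse of the quadratic times `a - z̄`; at the vector 1 this is the
`S`-resolvent. -/
theorem resolvent_mulLeft {T : A} {z : ℂ} (hz : IsUnit (quadratic T z)) :
    z ∈ resolventSet ℂ (φ.mulLeft T) ∧
      φ.toAlgebra (resolvent (φ.mulLeft T) z (φ.toAlgebra.symm 1)) = φ.sResolvent T z := by
  set q := Ring.inverse (quadratic T z) with hq
  have hq1 : q * quadratic T z = 1 := Ring.inverse_mul_cancel _ hz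
  have hTq : T * q = q * T := by
    obtain ⟨u, hu⟩ := hz
    rw [hq, ← hu, Ring.inverse_unit]
    exact (Commute.units_inv_right (hu ▸ commute_quadratic T z)).eq
  set a := φ.mulLeft T with ha
  set Y : φ.RightModule →L[ℂ] φ.RightModule :=
    -(φ.mulLeft q * (a - (starRingEnd ℂ z) • 1)) with hY
  have hYX : ∀ X, φ.toAlgebra (Y X)
      = -(q * (T * φ.toAlgebra X - φ.toAlgebra X * φ.hom (starRingEnd ℂ z))) := fun X => by
    simp [hY, toAlgebra_mulLeft, toAlgebra_smul, ha, mul_sub, mul_assoc]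
  have haX : ∀ X, φ.toAlgebra ((algebraMap ℂ _ z - a) X)
      = φ.toAlgebra X * φ.hom z - T * φ.toAlgebra X := fun X => by
    simp [toAlgebra_mulLeft, toAlgebra_smul, ha, Algebra.algebraMap_eq_smul_one]
  have hcomm : φ.hom (starRingEnd ℂ z) * φ.hom z = φ.hom z * φ.hom (starRingEnd ℂ z) := by
    rw [← map_mul, ← map_mul, mul_comm]
  have key : ∀ x : A, q * (T * (T * x) - (T * x) * (φ.hom z + φ.hom (starRingEnd ℂ z))
      + x * (φ.hom (starRingEnd ℂ z) * φ.hom z)) = x := fun x => by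
    rw [hom_add_hom_conj, hom_conj_mul_hom]
    calc _ = (q * quadratic T z) * x := by
          unfold quadratic
          simp only [mul_smul_comm, mul_one, mul_assoc, add_mul, sub_mul, smul_mul_assoc, one_mul,
            pow_two]
      _ = x := by rw [hq1, one_mul]
  have h1 : (algebraMap ℂ _ z - a) * Y = 1 := by
    ext X
    apply φ.toAlgebra.injective
    rw [ContinuousLinearMap.mul_def, ContinuousLinearMap.comp_apply, haX, hYX, one_apply_eq_self]
    set x := φ.toAlgebra X
    refine Eq.trans ?_ (key x)
    rw [mul_neg, ← mul_assoc T q, hTq]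
    noncomm_ring
  have h2 : Y * (algebraMap ℂ _ z - a) = 1 := by
    ext X
    apply φ.toAlgebra.injective
    rw [ContinuousLinearMap.mul_def, ContinuousLinearMap.comp_apply, hYX, haX, one_apply_eq_self]
    set x := φ.toAlgebra X
    refine Eq.trans ?_ (key x)
    simp only [sub_mul, mul_sub, mul_add, mul_assoc, hcomm]
    abel
  have hmem : z ∈ resolventSet ℂ a := spectrum.mem_resolventSet_of_left_right_inverse h1 h2
  refine ⟨hmem, ?_⟩
  have : resolvent a z = Y := by
    have h3 : resolvent a z * (algebraMap ℂ _ z - a) = 1 := Ring.inverse_mul_cancel _ hmem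
    calc resolvent a z = resolvent a z * ((algebraMap ℂ _ z - a) * Y) := by rw [h1, mul_one]
      _ = Y := by rw [← mul_assoc, h3, one_mul]
  rw [this, hYX]
  simp [sResolvent, hq]

variable [CompleteSpace A] {n : ℕ} {γ : Fin n → ℝ → ℂ} {U : Set ℂ} {T : A}

theorem continuousOn_sResolvent (T : A) :
    ContinuousOn (φ.sResolvent T) {z | IsUnit (quadratic T z)} := by
  have : ContinuousOn (fun z => φ.toAlgebra (resolvent (φ.mulLeft T) z (φ.toAlgebra.symm 1)))
      {z | IsUnit (quadratic T z)} :=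
    φ.continuous_toAlgebra.comp_continuousOn (((continuousOn_resolvent (φ.mulLeft T)).mono
      fun z hz => (φ.resolvent_mulLeft hz).1).clm_apply continuousOn_const)
  exact this.congr fun z hz => (φ.resolvent_mulLeft hz).2.symm

theorem intervalIntegrable_sResolvent_mul {γ : ℝ → ℂ} (hγ : IsClosedPiecewiseC1 γ)
    (hγU : ∀ t ∈ Icc (0 : ℝ) 1, IsUnit (quadratic T (γ t))) (m : ℕ) :
    IntervalIntegrable (fun t => φ.sResolvent T (γ t) * φ.hom (deriv γ t * γ t ^ m))
      volume 0 1 := by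
  have hc : ContinuousOn (fun t => φ.sResolvent T (γ t)) (uIcc 0 1) := by
    rw [uIcc_of_le zero_le_one]
    exact (φ.continuousOn_sResolvent T).comp hγ.continuousOn hγU
  have h1 := hγ.intervalIntegrable_deriv_smul (hγ.continuousOn.pow m)
  let L : ℂ →L[ℝ] A := φ.hom.toLinearMap.mkContinuous 1 fun z => by simpa using φ.norm_le z
  have h2 : IntervalIntegrable (fun t => φ.hom (deriv γ t * γ t ^ m)) volume 0 1 :=
    ⟨L.integrable_comp h1.1, L.integrable_comp h1.2⟩
  exact h2.continuousOn_mul hc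

/-- The complex identity for `aᵐ`, evaluated at the vector 1. Scalars act on the right, so `2πi`
reappears as a right factor. -/
theorem sum_integral_sResolvent_mul (hγ : ∀ k, IsClosedPiecewiseC1 (γ k)) (hU : IsOpen U)
    (hUb : Bornology.IsBounded U) (hγU : ∀ k, ∀ t ∈ Icc (0 : ℝ) 1, γ k t ∉ U)
    (hwind : ∀ w ∈ U, ∑ k, windingNumber (γ k) w = 1)
    (hT : ∀ z ∉ U, IsUnit (quadratic T z)) (m : ℕ) :
    ∑ k, ∫ t in (0 : ℝ)..1, φ.sResolvent T (γ k t) * φ.hom (deriv (γ k) t * γ k t ^ m)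
      = T ^ m * φ.hom (2 * Real.pi * Complex.I) := by
  set a := φ.mulLeft T
  have ha : spectrum ℂ a ⊆ U := fun z hz => by
    by_contra h
    exact hz (φ.resolvent_mulLeft (hT z h)).1
  -- The real structure that `φ.RightModule` inherits from `ℂ` is not by definition that of `A`;
  -- evaluation is therefore built as a continuous additive map, which is automatically real linear.
  let ev₀ : (φ.RightModule →L[ℂ] φ.RightModule) →+ A :=
    φ.toAlgebra.toAddMonoidHom.comp
      { toFun := fun X => X (φ.toAlgebra.symm 1)
        map_zero' := rfl
        map_add' := fun _ _ => rfl }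
  have hev₀ : Continuous ev₀ := φ.continuous_toAlgebra.comp
    (ContinuousLinearMap.apply ℂ φ.RightModule (φ.toAlgebra.symm 1)).continuous
  let ev := ev₀.toRealLinearMap hev₀
  have hev : ∀ X, ev X = φ.toAlgebra (X (φ.toAlgebra.symm 1)) := fun X => rfl
  have key := congrArg ev (sum_integral_pow_smul_resolvent hγ hU hUb hγU hwind ha m)
  rw [map_sum] at key
  refine Eq.trans (Finset.sum_congr rfl fun k _ => ?_) (key.trans ?_)
  · refine Eq.trans ?_ (ev.intervalIntegral_comp_comm
      ((hγ k).intervalIntegrable_deriv_smul (((hγ k).continuousOn.pow m).smul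
          (continuousOn_resolvent_comp (hγ k) (hγU k) ha))))
    refine intervalIntegral.integral_congr fun t ht => ?_
    rw [uIcc_of_le zero_le_one] at ht
    have := (φ.resolvent_mulLeft (hT _ (hγU k t ht))).2
    simp only [hev, smul_apply, toAlgebra_smul]
    rw [this, mul_assoc, ← map_mul, mul_comm (_ ^ m)]
  · rw [hev, smul_apply, toAlgebra_smul, toAlgebra_mulLeft_pow]
    simp

end ContractiveRep

/-! ## Algebra of slices -/

section Slice

variable {I : ℍ[ℝ]}

theorem normSq_of_mem_imagSphere (hI : I ∈ imagSphere) :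
    I.imI ^ 2 + I.imJ ^ 2 + I.imK ^ 2 = 1 := by
  have h := Quaternion.normSq_eq_norm_mul_self I
  rw [hI.2, Quaternion.normSq_def', hI.1] at h
  linarith

theorem mul_self_of_mem_imagSphere (hI : I ∈ imagSphere) : I * I = -1 := by
  have h := normSq_of_mem_imagSphere hI
  have h0 := hI.1
  ext
  · simp [Quaternion.re_mul, h0]; linarith
  · simp [Quaternion.imI_mul, h0]; ring
  · simp [Quaternion.imJ_mul, h0]; ring
  · simp [Quaternion.imK_mul, h0]; ring

theorem re_slice (hI : I ∈ imagSphere) (z : ℂ) : (slice I z).re = z.re := by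
  simp [slice, hI.1]

theorem norm_slice (hI : I ∈ imagSphere) (z : ℂ) : ‖slice I z‖ = ‖z‖ := by
  have h := normSq_of_mem_imagSphere hI
  rw [← sq_eq_sq₀ (norm_nonneg _) (norm_nonneg _), sq, ← Quaternion.normSq_eq_norm_mul_self,
    Quaternion.normSq_def', ← Complex.normSq_eq_norm_sq, Complex.normSq_apply]
  simp [slice, hI.1]
  linear_combination (z.im ^ 2) * h

theorem star_slice (hI : I ∈ imagSphere) (z : ℂ) :
    star (slice I z) = slice I (starRingEnd ℂ z) := by
  ext <;> simp [slice, hI.1, mul_comm]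

/-- The homomorphism `x + iy ↦ x + Iy` of real algebras. -/
def sliceHom (hI : I ∈ imagSphere) : ℂ →ₐ[ℝ] ℍ[ℝ] :=
  Complex.lift ⟨I, mul_self_of_mem_imagSphere hI⟩

theorem sliceHom_apply (hI : I ∈ imagSphere) (z : ℂ) : sliceHom hI z = slice I z := by
  rw [sliceHom, Complex.lift_apply, Complex.liftAux_apply, slice, ← Quaternion.coe_mul_eq_smul,
    Quaternion.coe_commutes]
  rfl

theorem sliceHom_I (hI : I ∈ imagSphere) : sliceHom hI Complex.I = I := by
  simp [sliceHom_apply, slice]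

theorem sliceHom_mul_comm (hI : I ∈ imagSphere) (z : ℂ) :
    sliceHom hI z * I = I * sliceHom hI z :=
  calc sliceHom hI z * I = sliceHom hI z * sliceHom hI Complex.I := by rw [sliceHom_I]
    _ = sliceHom hI Complex.I * sliceHom hI z := by rw [← map_mul, mul_comm, map_mul]
    _ = I * sliceHom hI z := by rw [sliceHom_I]

theorem exists_slice_eq (s : ℍ[ℝ]) : ∃ I ∈ imagSphere, ∃ z, slice I z = s := by
  by_cases h : s.im = 0
  · refine ⟨Quaternion.ofComplex Complex.I, ⟨by simp, ?_⟩, s.re, ?_⟩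
    · rw [← sq_eq_sq₀ (norm_nonneg _) zero_le_one, sq, ← Quaternion.normSq_eq_norm_mul_self,
        Quaternion.normSq_def']
      simp
    rw [← Quaternion.re_add_im s, h]
    simp [slice]
  · have h0 : ‖s.im‖ ≠ 0 := norm_ne_zero_iff.2 h
    refine ⟨‖s.im‖⁻¹ • s.im, ⟨by simp, ?_⟩, ⟨s.re, ‖s.im‖⟩, ?_⟩
    · rw [norm_smul, norm_inv, norm_norm, inv_mul_cancel₀ h0]
    · rw [slice, ← Quaternion.coe_commutes, Quaternion.coe_mul_eq_smul, smul_smul,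
        mul_inv_cancel₀ h0, one_smul, Quaternion.re_add_im]

end Slice

/-! ## Slice regular functions -/

/-- The chain rule turns the two partial derivatives into values of `fderiv` in the directions `1`
and `I`. -/
theorem leftRegularOn_iff {f : ℍ[ℝ] → ℍ[ℝ]} {Ω : Set ℍ[ℝ]} (hΩ : IsOpen Ω) :
    LeftRegularOn f Ω ↔ (∀ s ∈ Ω, DifferentiableAt ℝ f s) ∧
      ∀ I ∈ imagSphere, ∀ z, slice I z ∈ Ω →
        fderiv ℝ f (slice I z) 1 + I * fderiv ℝ f (slice I z) I = 0 := by
  have hcoe : ∀ x : ℝ, HasDerivAt (fun u : ℝ => (u : ℍ[ℝ])) 1 x := fun x =>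
    ((Algebra.linearMap ℝ ℍ[ℝ]).toContinuousLinearMap.hasDerivAt (x := x)).congr_deriv
      (by simp)
  have hx : ∀ (I : ℍ[ℝ]) (x y : ℝ), DifferentiableAt ℝ f (slice I ⟨x, y⟩) →
      deriv (fun u : ℝ => f ((u : ℍ[ℝ]) + I * (y : ℍ[ℝ]))) x = fderiv ℝ f (slice I ⟨x, y⟩) 1 :=
    fun I x y hd => (hd.hasFDerivAt.comp_hasDerivAt x ((hcoe x).add_const _)).deriv
  have hy : ∀ (I : ℍ[ℝ]) (x y : ℝ), DifferentiableAt ℝ f (slice I ⟨x, y⟩) →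
      deriv (fun v : ℝ => f ((x : ℍ[ℝ]) + I * (v : ℍ[ℝ]))) y = fderiv ℝ f (slice I ⟨x, y⟩) I := by
    intro I x y hd
    have := (hd.hasFDerivAt.comp_hasDerivAt y (((hcoe y).const_mul I).const_add (x : ℍ[ℝ]))).deriv
    rwa [mul_one] at this
  have hdiff : DifferentiableOn ℝ f Ω ↔ ∀ s ∈ Ω, DifferentiableAt ℝ f s :=
    forall₂_congr fun s hs => ⟨fun h => h.differentiableAt (hΩ.mem_nhds hs),
      fun h => h.differentiableWithinAt⟩
  rw [LeftRegularOn, hdiff]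
  refine and_congr_right fun hd => ⟨fun h I hI z hz => ?_, fun h I hI x y hz => ?_⟩
  · have := h I hI z.re z.im hz
    rw [hx I z.re z.im (hd _ hz), hy I z.re z.im (hd _ hz)] at this
    exact (smul_eq_zero.1 this).resolve_left (by norm_num)
  · rw [hx I x y (hd _ hz), hy I x y (hd _ hz)]
    exact smul_eq_zero_of_right _ (h I hI ⟨x, y⟩ hz)

/-- `f(s) = ∑ sⁿ aₙ` on the ball `B(0, R)`. -/
def HasRegularSeries (f : ℍ[ℝ] → ℍ[ℝ]) (a : ℕ → ℍ[ℝ]) (R : ℝ) : Prop :=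
  ∀ s ∈ Metric.ball (0 : ℍ[ℝ]) R, HasSum (fun n => s ^ n * a n) (f s)

theorem eq_of_hasSum_pow_smul {E : Type*} [NormedAddCommGroup E] [NormedSpace ℝ E]
    {a b : ℕ → E} {g : ℝ → E} {r : ℝ} (hr : 0 < r)
    (ha : ∀ x : ℝ, |x| < r → HasSum (fun n => x ^ n • a n) (g x))
    (hb : ∀ x : ℝ, |x| < r → HasSum (fun n => x ^ n • b n) (g x)) : a = b := by
  have hev : ∀ᶠ x : ℝ in 𝓝 0, |x| < r := by
    filter_upwards [Metric.ball_mem_nhds (0 : ℝ) hr] with x hx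
    simpa using hx
  let p : (ℕ → E) → FormalMultilinearSeries ℝ ℝ E := fun c n =>
    ContinuousMultilinearMap.mkPiRing ℝ (Fin n) (c n)
  have hp : ∀ c n, (p c).coeff n = c n := fun c n => by
    simp [p, FormalMultilinearSeries.coeff]
  have key : ∀ c : ℕ → E, (∀ x : ℝ, |x| < r → HasSum (fun n => x ^ n • c n) (g x)) →
      HasFPowerSeriesAt g (p c) 0 := by
    intro c hc
    rw [hasFPowerSeriesAt_iff]
    filter_upwards [hev] with x hx
    simpa only [hp, zero_add] using hc x hx
  have h := (key a ha).eq_formalMultilinearSeries (key b hb)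
  funext n
  have := congrArg (fun p => FormalMultilinearSeries.coeff p n) h
  simpa only [hp] using this

/-- Let `ℂ` act on `ℍ` by left multiplication through `L_I`. The regularity equation says that the
real derivative satisfies `L I = I * L 1`, so `f` restricted to the slice is complex differentiable
and has a Taylor series. The coefficients may still depend on `I`. -/
theorem LeftRegularOn.exists_slice_series {f : ℍ[ℝ] → ℍ[ℝ]} {R : ℝ}
    (hf : LeftRegularOn f (Metric.ball 0 R)) {I : ℍ[ℝ]} (hI : I ∈ imagSphere) :
    ∃ a : ℕ → ℍ[ℝ], ∀ z : ℂ, ‖z‖ < R → HasSum (fun n => slice I z ^ n * a n) (f (slice I z)) := by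
  rw [leftRegularOn_iff Metric.isOpen_ball] at hf
  let _ : Module ℂ ℍ[ℝ] := Module.compHom ℍ[ℝ] (sliceHom hI).toRingHom
  have hsmul : ∀ (z : ℂ) (q : ℍ[ℝ]), z • q = slice I z * q := fun z q =>
    congrArg (· * q) (sliceHom_apply hI z)
  let _ : NormedSpace ℂ ℍ[ℝ] := ⟨fun z q => by rw [hsmul, norm_mul, norm_slice hI]⟩
  have hd : DifferentiableOn ℂ (fun z => f (slice I z)) (Metric.ball 0 R) := by
    intro z hz
    have hs : slice I z ∈ Metric.ball (0 : ℍ[ℝ]) R := by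
      rw [mem_ball_zero_iff] at hz ⊢
      rwa [norm_slice hI]
    set L := fderiv ℝ f (slice I z)
    have hL : L I = I * L 1 := by
      have := congrArg (I * ·) (hf.2 I hI z hs)
      simp only [mul_add, mul_zero, ← mul_assoc, mul_self_of_mem_imagSphere hI] at this
      rw [neg_mul, one_mul, ← sub_eq_add_neg, sub_eq_zero] at this
      exact this.symm
    have hLs : ∀ w : ℂ, L (slice I w) = w • L 1 := by
      intro w
      rw [hsmul, slice, ← Quaternion.coe_commutes, Quaternion.coe_mul_eq_smul,
        ← mul_one (w.re : ℍ[ℝ]), Quaternion.coe_mul_eq_smul, map_add, map_smul, map_smul, hL,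
        add_mul, smul_mul_assoc, smul_mul_assoc, one_mul]
    have h1 : HasFDerivAt (fun w => f (slice I w))
        (L.comp (sliceHom hI).toLinearMap.toContinuousLinearMap) z := by
      have h2 := (sliceHom hI).toLinearMap.toContinuousLinearMap.hasFDerivAt (x := z)
      have h3 : HasFDerivAt f L ((sliceHom hI).toLinearMap.toContinuousLinearMap z) := by
        have : (sliceHom hI).toLinearMap.toContinuousLinearMap z = slice I z :=
          sliceHom_apply hI z
        rw [this]
        exact (hf.1 _ hs).hasFDerivAt
      refine (h3.comp z h2).congr_of_eventuallyEq (Eventually.of_forall fun w => ?_)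
      exact congrArg f (sliceHom_apply hI w).symm
    have h4 : HasDerivAt (fun w => f (slice I w)) (L 1) z := by
      rw [hasDerivAt_iff_isLittleO]
      rw [hasFDerivAt_iff_isLittleO] at h1
      refine h1.congr_left fun w => ?_
      rw [← hLs, ← sliceHom_apply hI (w - z)]
      rfl
    exact h4.differentiableAt.differentiableWithinAt
  refine ⟨fun n => (n.factorial : ℂ)⁻¹ • iteratedDeriv n (fun z => f (slice I z)) 0,
    fun z hz => ?_⟩
  have h := Complex.hasSum_taylorSeries_on_ball hd (z := z) (by simpa using hz)
  refine (congrArg (fun u => HasSum u _) (funext fun n => ?_)).mp h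
  rw [smul_comm, ← sliceHom_apply hI z, ← map_pow, sliceHom_apply hI, ← hsmul, sub_zero]

/-- The real axis lies in every slice, and a power series is determined by its values there. -/
theorem LeftRegularOn.exists_series {f : ℍ[ℝ] → ℍ[ℝ]} {R : ℝ} (hR : 0 < R)
    (hf : LeftRegularOn f (Metric.ball 0 R)) : ∃ a, HasRegularSeries f a R := by
  have hreal : ∀ {I : ℍ[ℝ]} (x : ℝ), slice I x = x := fun x => by simp [slice]
  have key : ∀ {I : ℍ[ℝ]} {a : ℕ → ℍ[ℝ]}, (∀ z : ℂ, ‖z‖ < R →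
      HasSum (fun n => slice I z ^ n * a n) (f (slice I z))) →
      ∀ x : ℝ, |x| < R → HasSum (fun n => x ^ n • a n) (f x) := by
    intro I a h x hx
    have := h x (by simpa using hx)
    simp only [hreal, ← Quaternion.coe_pow, Quaternion.coe_mul_eq_smul] at this
    exact this
  obtain ⟨I₀, hI₀, -⟩ := exists_slice_eq 0
  obtain ⟨a, ha⟩ := hf.exists_slice_series hI₀
  refine ⟨a, fun s hs => ?_⟩
  obtain ⟨I, hI, z, rfl⟩ := exists_slice_eq s
  obtain ⟨b, hb⟩ := hf.exists_slice_series hI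
  rw [eq_of_hasSum_pow_smul hR (key ha) (key hb)]
  exact hb z (by rwa [mem_ball_zero_iff, norm_slice hI] at hs)

namespace HasRegularSeries

variable {f g : ℍ[ℝ] → ℍ[ℝ]} {a b : ℕ → ℍ[ℝ]} {R R' : ℝ}

theorem mono (h : HasRegularSeries f a R) (hR : R' ≤ R) : HasRegularSeries f a R' :=
  fun s hs => h s (Metric.ball_subset_ball hR hs)

theorem hasSum_pow_smul (h : HasRegularSeries f a R) (x : ℝ) (hx : |x| < R) :
    HasSum (fun n => x ^ n • a n) (f x) := by
  have := h x (by simpa using hx)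
  simpa only [← Quaternion.coe_pow, Quaternion.coe_mul_eq_smul] using this

theorem unique (ha : HasRegularSeries f a R) (hb : HasRegularSeries f b R') (hR : 0 < R)
    (hR' : 0 < R') : a = b :=
  eq_of_hasSum_pow_smul (lt_min hR hR')
    (fun x hx => ha.hasSum_pow_smul x (hx.trans_le (min_le_left _ _)))
    (fun x hx => hb.hasSum_pow_smul x (hx.trans_le (min_le_right _ _)))

theorem add (ha : HasRegularSeries f a R) (hb : HasRegularSeries g b R) :
    HasRegularSeries (f + g) (a + b) R := fun s hs => by
  simpa [mul_add] using (ha s hs).add (hb s hs)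

theorem mul_const (ha : HasRegularSeries f a R) (c : ℍ[ℝ]) :
    HasRegularSeries (fun s => f s * c) (fun n => a n * c) R := fun s hs => by
  simpa [mul_assoc] using (ha s hs).mul_right c

/-- The terms at a real point `r` between `ρ` and `R` are bounded; compare with the geometric series
of ratio `ρ / r`. -/
theorem summable_norm (ha : HasRegularSeries f a R) {ρ : ℝ} (h0 : 0 ≤ ρ) (hρ : ρ < R) :
    Summable fun n => ρ ^ n * ‖a n‖ := by
  obtain ⟨r, hr, hrR⟩ := exists_between hρ
  have hr0 : 0 < r := h0.trans_lt hr
  have hs := (ha.hasSum_pow_smul r (by rwa [abs_of_pos hr0])).summable.tendsto_atTop_zero.norm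
  obtain ⟨C, hC⟩ := hs.bddAbove_range
  have hlt : ρ / r < 1 := (div_lt_one hr0).2 hr
  refine Summable.of_nonneg_of_le (fun n => by positivity) (fun n => ?_)
    ((summable_geometric_of_lt_one (by positivity) hlt).mul_left C)
  have h1 : r ^ n * ‖a n‖ ≤ C := by
    have := hC (mem_range_self n)
    rwa [norm_smul, norm_pow, Real.norm_of_nonneg hr0.le] at this
  calc ρ ^ n * ‖a n‖ = (r ^ n * ‖a n‖) * (ρ / r) ^ n := by
        rw [div_pow]; field_simp
    _ ≤ _ := by gcongr

/-- Cauchy product: real coefficients commute with `s`, so the powers of `s` can be collected on the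
left. -/
theorem mul (a b : ℕ → ℝ) (ha : HasRegularSeries f (fun n => (a n : ℍ[ℝ])) R)
    (hb : HasRegularSeries g (fun n => (b n : ℍ[ℝ])) R) :
    HasRegularSeries (f * g)
      (fun n => ((∑ k ∈ Finset.range (n + 1), a k * b (n - k) : ℝ) : ℍ[ℝ])) R := by
  intro s hs
  rw [mem_ball_zero_iff] at hs
  have h1 := ha.summable_norm (norm_nonneg s) hs
  have h2 := hb.summable_norm (norm_nonneg s) hs
  simp only [← norm_pow, ← norm_mul] at h1 h2
  have h := hasSum_sum_range_mul_of_summable_norm h1 h2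
  rw [(ha s (by simpa using hs)).tsum_eq, (hb s (by simpa using hs)).tsum_eq] at h
  refine (congrArg (fun u => HasSum u _) (funext fun n => Eq.symm ?_)).mp h
  dsimp only
  rw [← Quaternion.algebraMap_def, map_sum, Finset.mul_sum]
  refine Finset.sum_congr rfl fun k hk => ?_
  rw [map_mul, Quaternion.algebraMap_def, mul_assoc, ← mul_assoc (a k : ℍ[ℝ]),
    Quaternion.coe_commutes (a k) (s ^ (n - k)), mul_assoc, ← mul_assoc (s ^ k), ← pow_add,
    Nat.add_sub_cancel' (Nat.lt_succ_iff.1 (Finset.mem_range.1 hk))]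

end HasRegularSeries

/-! ## Operations on slice regular functions -/

namespace LeftRegularOn

variable {f g : ℍ[ℝ] → ℍ[ℝ]} {Ω Ω' : Set ℍ[ℝ]}

theorem mono (hf : LeftRegularOn f Ω) (h : Ω' ⊆ Ω) : LeftRegularOn f Ω' :=
  ⟨hf.1.mono h, fun I hI x y hxy => hf.2 I hI x y (h hxy)⟩

theorem add (hΩ : IsOpen Ω) (hf : LeftRegularOn f Ω) (hg : LeftRegularOn g Ω) :
    LeftRegularOn (f + g) Ω := by
  rw [leftRegularOn_iff hΩ] at *
  refine ⟨fun s hs => (hf.1 s hs).add (hg.1 s hs), fun I hI z hz => ?_⟩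
  rw [fderiv_add (hf.1 _ hz) (hg.1 _ hz)]
  have h1 := hf.2 I hI z hz
  have h2 := hg.2 I hI z hz
  calc _ = (fderiv ℝ f (slice I z) 1 + I * fderiv ℝ f (slice I z) I)
        + (fderiv ℝ g (slice I z) 1 + I * fderiv ℝ g (slice I z) I) := by
          simp only [add_apply, mul_add]; abel
    _ = 0 := by rw [h1, h2, add_zero]

/-- The product of two slice regular functions, the first of which maps slices into themselves. -/
theorem mul (hΩ : IsOpen Ω) (hf : LeftRegularOn f Ω) (hg : LeftRegularOn g Ω)
    (hcomm : ∀ I ∈ imagSphere, ∀ z, slice I z ∈ Ω → I * f (slice I z) = f (slice I z) * I) :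
    LeftRegularOn (f * g) Ω := by
  rw [leftRegularOn_iff hΩ] at *
  refine ⟨fun s hs => (hf.1 s hs).mul (hg.1 s hs), fun I hI z hz => ?_⟩
  rw [fderiv_mul' (hf.1 _ hz) (hg.1 _ hz)]
  have h1 := hf.2 I hI z hz
  have h2 := hg.2 I hI z hz
  calc _ = (fderiv ℝ f (slice I z) 1 + I * fderiv ℝ f (slice I z) I) * g (slice I z)
        + f (slice I z) * (fderiv ℝ g (slice I z) 1 + I * fderiv ℝ g (slice I z) I) := by
          simp only [add_apply, smul_apply, smul_eq_mul,
            MulOpposite.smul_eq_mul_unop, MulOpposite.unop_op, mul_add, add_mul, ← mul_assoc,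
            hcomm I hI z hz]
          abel
    _ = 0 := by rw [h1, h2, zero_mul, mul_zero, add_zero]

theorem mul_const (hΩ : IsOpen Ω) (hf : LeftRegularOn f Ω) (c : ℍ[ℝ]) :
    LeftRegularOn (fun s => f s * c) Ω := by
  rw [leftRegularOn_iff hΩ] at *
  refine ⟨fun s hs => (hf.1 s hs).mul_const c, fun I hI z hz => ?_⟩
  rw [fderiv_mul_const' (hf.1 _ hz)]
  simpa [add_mul, mul_assoc] using congrArg (· * c) (hf.2 I hI z hz)

end LeftRegularOn

/-! ## Disks as slice domains -/

/-- The counterclockwise circle around `0`, parametrized by `[0, 1]`. -/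
def circleCurve (ρ t : ℝ) : ℂ := circleMap 0 ρ (2 * Real.pi * t)

theorem windingNumber_circleCurve (ρ : ℝ) (w : ℂ) :
    windingNumber (circleCurve ρ) w
      = (2 * Real.pi * Complex.I)⁻¹ * ∮ z in C(0, ρ), (z - w)⁻¹ := by
  have hd : ∀ t, deriv (circleCurve ρ) t
      = (2 * Real.pi) • deriv (circleMap 0 ρ) (2 * Real.pi * t) := by
    intro t
    have h := (hasDerivAt_circleMap 0 ρ (2 * Real.pi * t)).scomp t
      ((hasDerivAt_id t).const_mul (2 * Real.pi))
    rw [mul_one] at h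
    rw [deriv_circleMap]
    exact h.deriv
  have h := intervalIntegral.smul_integral_comp_mul_left (a := 0) (b := 1)
    (fun θ => deriv (circleMap 0 ρ) θ • (circleMap 0 ρ θ - w)⁻¹) (2 * Real.pi)
  rw [mul_zero, mul_one] at h
  rw [windingNumber, circleIntegral, ← h, ← intervalIntegral.integral_smul]
  congr 1
  refine intervalIntegral.integral_congr fun t _ => ?_
  rw [hd, div_eq_mul_inv, smul_mul_assoc]
  rfl

/-- The disk of radius `ρ` around `0` in the slice `L_I`. -/
def diskDomain {I : ℍ[ℝ]} (hI : I ∈ imagSphere) {ρ : ℝ} (hρ : 0 < ρ) : SliceDomain where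
  I := I
  I_mem := hI
  U := Metric.ball 0 ρ
  isOpen := Metric.isOpen_ball
  isBounded := Metric.isBounded_ball
  n := 1
  γ := fun _ => circleCurve ρ
  closed_curve := fun _ => by
    refine ⟨by simp [circleCurve, circleMap], 1, ![0, 1], ?_, rfl, rfl, fun _ => ?_⟩
    · intro i j hij
      fin_cases i <;> fin_cases j <;> simp_all
    · exact ((contDiff_circleMap 0 ρ).comp (contDiff_const.mul contDiff_id)).contDiffOn
  image_eq := by
    rw [frontier_ball _ hρ.ne', iUnion_const, ← abs_of_pos hρ, ← range_circleMap, abs_of_pos hρ]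
    refine Subset.antisymm (image_subset_iff.2 fun t _ => mem_range_self _) ?_
    rw [range_circleMap, ← image_circleMap_Ioc]
    rintro _ ⟨θ, hθ, rfl⟩
    have h2 := Real.two_pi_pos
    refine ⟨θ / (2 * Real.pi), ⟨by have := hθ.1; positivity, (div_le_one h2).2 hθ.2⟩, ?_⟩
    rw [circleCurve, mul_div_cancel₀ _ h2.ne']
  winding_inside := fun w hw => by
    simp [windingNumber_circleCurve, circleIntegral.integral_sub_inv_of_mem_ball hw, -mul_inv_rev]
  winding_outside := fun w hw => by
    rw [closure_ball _ hρ.ne'] at hw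
    have h0 : ∮ z in C(0, ρ), (z - w)⁻¹ = 0 := by
      refine DiffContOnCl.circleIntegral_eq_zero hρ.le (DifferentiableOn.diffContOnCl ?_)
      rw [closure_ball _ hρ.ne']
      intro z hz
      refine ((differentiableAt_id.sub_const w).inv (sub_ne_zero.2 ?_)).differentiableWithinAt
      rintro rfl
      exact hw hz
    simp [windingNumber_circleCurve, h0]

/-! ## Operators -/

section Operators

variable {V : Type*} [NormedAddCommGroup V] [NormedSpace ℝ V]
  [Module ℍ[ℝ] V] [IsBoundedSMul ℍ[ℝ] V] [IsScalarTower ℝ ℍ[ℝ] V]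
  [Module ℍ[ℝ]ᵐᵒᵖ V] [IsBoundedSMul ℍ[ℝ]ᵐᵒᵖ V] [IsScalarTower ℝ ℍ[ℝ]ᵐᵒᵖ V]
  [SMulCommClass ℍ[ℝ] ℍ[ℝ]ᵐᵒᵖ V]

theorem leftMul_apply (a : ℍ[ℝ]) (v : V) : (leftMul a : BoundedOp V).1 v = a • v := rfl

theorem boundedOp_ext {S T : BoundedOp V} (h : ∀ v, S.1 v = T.1 v) : S = T :=
  Subtype.ext (ContinuousLinearMap.ext h)

variable (V) in
/-- `a ↦ a 𝓘` as a homomorphism of real algebras. -/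
def leftMulHom : ℍ[ℝ] →ₐ[ℝ] BoundedOp V where
  toFun := leftMul
  map_one' := boundedOp_ext fun v => one_smul _ v
  map_mul' a b := boundedOp_ext fun v => mul_smul a b v
  map_zero' := boundedOp_ext fun v => zero_smul _ v
  map_add' a b := boundedOp_ext fun v => add_smul a b v
  commutes' r := boundedOp_ext fun v => by
    rw [leftMul_apply, algebraMap_smul]
    rfl

theorem leftMulHom_apply (a : ℍ[ℝ]) : leftMulHom V a = leftMul a := rfl

theorem norm_leftMul_le (a : ℍ[ℝ]) : ‖(leftMul a : BoundedOp V)‖ ≤ ‖a‖ :=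
  ContinuousLinearMap.opNorm_le_bound _ (norm_nonneg a) fun v => norm_smul_le a v

variable (V) in
/-- The representation of `ℂ` on `V` that is defined by an imaginary unit. -/
def sliceRep {I : ℍ[ℝ]} (hI : I ∈ imagSphere) : ContractiveRep (BoundedOp V) where
  hom := (leftMulHom V).comp (sliceHom hI)
  norm_le z := by
    rw [AlgHom.comp_apply, leftMulHom_apply, sliceHom_apply, ← norm_slice hI z]
    exact norm_leftMul_le _

theorem sliceRep_hom {I : ℍ[ℝ]} (hI : I ∈ imagSphere) (z : ℂ) :
    (sliceRep V hI).hom z = leftMul (slice I z) := by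
  rw [← sliceHom_apply hI]; rfl

theorem quadratic_eq_sPolynomial {I : ℍ[ℝ]} (hI : I ∈ imagSphere) (T : BoundedOp V) (z : ℂ) :
    ContractiveRep.quadratic T z = sPolynomial (slice I z) T := by
  rw [ContractiveRep.quadratic, sPolynomial, re_slice hI, norm_slice hI]

theorem sliceRep_sResolvent {I : ℍ[ℝ]} (hI : I ∈ imagSphere) (T : BoundedOp V) (z : ℂ) :
    (sliceRep V hI).sResolvent T z = sResolvent (slice I z) T := by
  rw [ContractiveRep.sResolvent, sResolvent, quadratic_eq_sPolynomial hI, sliceRep_hom,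
    star_slice hI]

theorem isClosed_sSpectrum [CompleteSpace V] (T : BoundedOp V) : IsClosed (sSpectrum T) := by
  have hc : Continuous fun s : ℍ[ℝ] => sPolynomial s T := by
    unfold sPolynomial
    have := Quaternion.continuous_re
    fun_prop
  exact (Units.isOpen.preimage hc).isClosed_compl

/-! ### Cauchy integrals of power series over a slice domain -/

namespace SliceDomain

variable (D : SliceDomain)

theorem curve_mem_frontier (k : Fin D.n) {t : ℝ} (ht : t ∈ Icc (0 : ℝ) 1) :
    D.γ k t ∈ frontier D.U := by
  rw [← D.image_eq]
  exact mem_iUnion_of_mem k (mem_image_of_mem _ ht)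

theorem curve_notMem (k : Fin D.n) {t : ℝ} (ht : t ∈ Icc (0 : ℝ) 1) : D.γ k t ∉ D.U := by
  have := D.curve_mem_frontier k ht
  rw [D.isOpen.frontier_eq] at this
  exact this.2

/-- The spectrum in the slice is contained in `U`. -/
def Encloses (T : BoundedOp V) : Prop := ∀ z : ℂ, slice D.I z ∈ sSpectrum T → z ∈ D.U

/-- The integrand of the Cauchy integral of `sᵐ`. -/
def powIntegrand (T : BoundedOp V) (k : Fin D.n) (m : ℕ) (t : ℝ) : BoundedOp V :=
  (sliceRep V D.I_mem).sResolvent T (D.γ k t) *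
    (sliceRep V D.I_mem).hom (deriv (D.γ k) t * D.γ k t ^ m)

variable {D} {T : BoundedOp V}

theorem Encloses.isUnit_quadratic (hD : D.Encloses T) {z : ℂ} (hz : z ∉ D.U) :
    IsUnit (ContractiveRep.quadratic T z) := by
  rw [quadratic_eq_sPolynomial D.I_mem]
  by_contra h
  exact hz (hD z h)

variable [CompleteSpace V]

theorem Encloses.sum_integral_powIntegrand (hD : D.Encloses T) (m : ℕ) :
    ∑ k, ∫ t in (0 : ℝ)..1, D.powIntegrand T k m t
      = T ^ m * (sliceRep V D.I_mem).hom (2 * Real.pi * Complex.I) :=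
  (sliceRep V D.I_mem).sum_integral_sResolvent_mul D.closed_curve D.isOpen D.isBounded
    (fun k _ ht => D.curve_notMem k ht) D.winding_inside (fun _ hz => hD.isUnit_quadratic hz) m

theorem Encloses.intervalIntegrable_powIntegrand (hD : D.Encloses T) (k : Fin D.n) (m : ℕ) :
    IntervalIntegrable (D.powIntegrand T k m) volume 0 1 :=
  (sliceRep V D.I_mem).intervalIntegrable_sResolvent_mul (D.closed_curve k)
    (fun _ ht => hD.isUnit_quadratic (D.curve_notMem k ht)) m

theorem Encloses.exists_norm_powIntegrand_le (hD : D.Encloses T) {ρ : ℝ}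
    (hρ : ∀ z ∈ closure D.U, ‖z‖ ≤ ρ) :
    ∃ C, 0 ≤ C ∧ ∀ k m, ∀ᵐ t, t ∈ uIoc (0 : ℝ) 1 → ‖D.powIntegrand T k m t‖ ≤ C * ρ ^ m := by
  have key : ∀ k, ∃ C, 0 ≤ C ∧ ∀ m, ∀ᵐ t, t ∈ uIoc (0 : ℝ) 1 →
      ‖D.powIntegrand T k m t‖ ≤ C * ρ ^ m := by
    intro k
    have hc : ContinuousOn (fun t => (sliceRep V D.I_mem).sResolvent T (D.γ k t)) (Icc 0 1) :=
      ((sliceRep V D.I_mem).continuousOn_sResolvent T).comp (D.closed_curve k).continuousOn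
        fun t ht => hD.isUnit_quadratic (D.curve_notMem k ht)
    obtain ⟨K, hK⟩ := isCompact_Icc.exists_bound_of_continuousOn hc
    obtain ⟨C, hC0, hC⟩ := (D.closed_curve k).exists_ae_bound_deriv
    refine ⟨|K| * C, by positivity, fun m => ?_⟩
    filter_upwards [hC] with t ht htI
    have htI' : t ∈ Icc (0 : ℝ) 1 := by
      rw [uIoc_of_le zero_le_one] at htI
      exact Ioc_subset_Icc_self htI
    have h1 := (hK t htI').trans (le_abs_self K)
    have h2 : ‖(sliceRep V D.I_mem).hom (deriv (D.γ k) t * D.γ k t ^ m)‖ ≤ C * ρ ^ m := by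
      refine ((sliceRep V D.I_mem).norm_le _).trans ?_
      rw [norm_mul, norm_pow]
      have := hρ _ (frontier_subset_closure (D.curve_mem_frontier k htI'))
      have := ht htI
      gcongr
    rw [mul_assoc]
    exact (norm_mul_le _ _).trans (mul_le_mul h1 h2 (norm_nonneg _) (abs_nonneg K))
  choose C hC0 hC using key
  refine ⟨∑ k, C k, Finset.sum_nonneg fun k _ => hC0 k, fun k m => ?_⟩
  filter_upwards [hC k m] with t ht htI
  have hρ0 : 0 ≤ ρ := by
    rw [uIoc_of_le zero_le_one] at htI
    exact (norm_nonneg _).trans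
      (hρ _ (frontier_subset_closure (D.curve_mem_frontier k (Ioc_subset_Icc_self htI))))
  refine (ht htI).trans ?_
  gcongr
  exact Finset.single_le_sum (fun k _ => hC0 k) (Finset.mem_univ k)

/-- `Tᵐ` is itself a Cauchy integral, of `sᵐ` over curves in the disk of radius `ρ`; this replaces a
spectral radius formula. -/
theorem Encloses.exists_norm_pow_le (hD : D.Encloses T) {ρ : ℝ}
    (hρ : ∀ z ∈ closure D.U, ‖z‖ ≤ ρ) : ∃ C, ∀ m : ℕ, ‖T ^ m‖ ≤ C * ρ ^ m := by
  obtain ⟨C, hC0, hC⟩ := hD.exists_norm_powIntegrand_le hρ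
  set φ := sliceRep V D.I_mem
  have h0 : (2 * Real.pi * Complex.I : ℂ) ≠ 0 := by simp [Real.pi_ne_zero]
  refine ⟨D.n * C * ‖φ.hom (2 * Real.pi * Complex.I)⁻¹‖, fun m => ?_⟩
  have h1 : T ^ m = (∑ k, ∫ t in (0 : ℝ)..1, D.powIntegrand T k m t)
      * φ.hom (2 * Real.pi * Complex.I)⁻¹ := by
    rw [hD.sum_integral_powIntegrand, mul_assoc, ← map_mul, mul_inv_cancel₀ h0, map_one, mul_one]
  have h2 : ‖∑ k, ∫ t in (0 : ℝ)..1, D.powIntegrand T k m t‖ ≤ D.n * (C * ρ ^ m) := by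
    refine (norm_sum_le _ _).trans ?_
    have : ∀ k ∈ Finset.univ, ‖∫ t in (0 : ℝ)..1, D.powIntegrand T k m t‖ ≤ C * ρ ^ m :=
      fun k _ =>
        (intervalIntegral.norm_integral_le_of_norm_le_const_ae (hC k m)).trans_eq (by simp)
    refine (Finset.sum_le_card_nsmul _ _ _ this).trans_eq ?_
    rw [Finset.card_univ, Fintype.card_fin, nsmul_eq_mul]
  calc ‖T ^ m‖ ≤ D.n * (C * ρ ^ m) * ‖φ.hom (2 * Real.pi * Complex.I)⁻¹‖ := by
        rw [h1]
        exact (norm_mul_le _ _).trans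
          (mul_le_mul_of_nonneg_right h2 (norm_nonneg _))
    _ = _ := by ring

theorem exists_radius (D : SliceDomain) {R : ℝ} (hR : 0 < R)
    (h : ∀ z ∈ closure D.U, slice D.I z ∈ Metric.ball (0 : ℍ[ℝ]) R) :
    ∃ ρ, 0 < ρ ∧ ρ < R ∧ ∀ z ∈ closure D.U, ‖z‖ ≤ ρ := by
  obtain ⟨ρ, hρ, hU⟩ := exists_pos_lt_subset_ball (x := (0 : ℂ)) hR
    (isClosed_closure (s := D.U)) fun z hz => by
      simpa [norm_slice D.I_mem] using h z hz
  exact ⟨ρ, hρ.1, hρ.2, fun z hz => (mem_ball_zero_iff.1 (hU hz)).le⟩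

theorem Encloses.summable_norm (hD : D.Encloses T) {f : ℍ[ℝ] → ℍ[ℝ]} {a : ℕ → ℍ[ℝ]} {R : ℝ}
    (hR : 0 < R) (h : ∀ z ∈ closure D.U, slice D.I z ∈ Metric.ball (0 : ℍ[ℝ]) R)
    (hf : HasRegularSeries f a R) :
    Summable fun m => ‖T ^ m * leftMul (a m)‖ := by
  obtain ⟨ρ, hρ0, hρR, hρ⟩ := D.exists_radius hR h
  obtain ⟨C, hC⟩ := hD.exists_norm_pow_le hρ
  refine Summable.of_nonneg_of_le (fun m => norm_nonneg _) (fun m => ?_)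
    ((hf.summable_norm hρ0.le hρR).mul_left C)
  rw [← mul_assoc]
  exact (norm_mul_le _ _).trans (mul_le_mul (hC m) (norm_leftMul_le _) (norm_nonneg _)
    ((norm_nonneg _).trans (hC m)))

/-- Expand `f` along the boundary and integrate term by term, dominated by `C ρᵐ ‖aₘ‖`. -/
theorem Encloses.hasSum_cauchyIntegral (hD : D.Encloses T) {f : ℍ[ℝ] → ℍ[ℝ]} {a : ℕ → ℍ[ℝ]}
    {R : ℝ} (hR : 0 < R) (h : ∀ z ∈ closure D.U, slice D.I z ∈ Metric.ball (0 : ℍ[ℝ]) R)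
    (hf : HasRegularSeries f a R) :
    HasSum (fun m => T ^ m * leftMul (a m)) (D.cauchyIntegral T f) := by
  obtain ⟨ρ, hρ0, hρR, hρ⟩ := D.exists_radius hR h
  obtain ⟨C, hC0, hC⟩ := hD.exists_norm_powIntegrand_le hρ
  set φ := sliceRep V D.I_mem
  have hk : ∀ k, HasSum
      (fun m => ∫ t in (0 : ℝ)..1, D.powIntegrand T k m t * leftMul (-D.I * a m))
      (∫ t in (0 : ℝ)..1, sResolvent (slice D.I (D.γ k t)) T *
        leftMul (-D.I * slice D.I (deriv (D.γ k) t)) * leftMul (f (slice D.I (D.γ k t)))) := by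
    intro k
    have hsum := (hf.summable_norm hρ0.le hρR).mul_left C
    refine intervalIntegral.hasSum_integral_of_dominated_convergence
      (fun m _ => C * (ρ ^ m * ‖a m‖)) (fun m => ?_) (fun m => ?_) ?_ ?_ ?_
    · exact (intervalIntegrable_iff.1
        ((hD.intervalIntegrable_powIntegrand k m).mul_const _)).aestronglyMeasurable
    · filter_upwards [hC k m] with t ht htI
      refine (norm_mul_le _ _).trans ?_
      rw [← mul_assoc]
      refine mul_le_mul (ht htI) ((norm_leftMul_le _).trans ?_) (norm_nonneg _) (by positivity)
      rw [norm_mul, norm_neg, D.I_mem.2, one_mul]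
    · exact Eventually.of_forall fun t _ => hsum
    · exact intervalIntegrable_const
    · refine Eventually.of_forall fun t htI => ?_
      have htI' : t ∈ Icc (0 : ℝ) 1 := by
        rw [uIoc_of_le zero_le_one] at htI
        exact Ioc_subset_Icc_self htI
      have hs := hf _ (h _ (frontier_subset_closure (D.curve_mem_frontier k htI')))
      have hs' := (hs.mapL ((leftMulHom V).toLinearMap.toContinuousLinearMap)).mul_left
        (sResolvent (slice D.I (D.γ k t)) T * leftMul (-D.I * slice D.I (deriv (D.γ k) t)))
      refine (congrArg (fun u => HasSum u _) (funext fun m => ?_)).mp hs'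
      rw [powIntegrand, sliceRep_sResolvent, sliceRep_hom, mul_assoc, mul_assoc]
      congr 1
      change leftMulHom V _ * leftMulHom V _ = leftMulHom V _ * leftMulHom V _
      -- Everything except `a m` lies in the commutative plane `L_I`, so the factor `-I` of `ds_I`
      -- can be moved next to `a m`, out of the integral.
      have e : -D.I * slice D.I (deriv (D.γ k) t) * (slice D.I (D.γ k t) ^ m * a m)
          = slice D.I (deriv (D.γ k) t * D.γ k t ^ m) * (-D.I * a m) := by
        rw [← sliceHom_apply D.I_mem, ← sliceHom_apply D.I_mem, ← sliceHom_apply D.I_mem,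
          ← mul_assoc _ (-D.I), mul_neg, sliceHom_mul_comm, map_mul, map_pow]
        simp only [neg_mul, mul_assoc]
      rw [← map_mul, ← map_mul, e]
  have hS := (hasSum_sum fun k (_ : k ∈ Finset.univ) => hk k).const_smul (1 / (2 * Real.pi))
  refine (congrArg (fun u => HasSum u _) (funext fun m => ?_)).mp hS
  have : ∀ k, ∫ t in (0 : ℝ)..1, D.powIntegrand T k m t * leftMul (-D.I * a m)
      = (∫ t in (0 : ℝ)..1, D.powIntegrand T k m t) * leftMul (-D.I * a m) := fun k =>
    integral_mul_const_of_intervalIntegrable (hD.intervalIntegrable_powIntegrand k m) _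
  rw [Finset.sum_congr rfl fun k _ => this k, ← Finset.sum_mul, hD.sum_integral_powIntegrand,
    sliceRep_hom, mul_assoc, ← mul_smul_comm]
  congr 1
  change _ • (leftMulHom V _ * leftMulHom V _) = leftMulHom V _
  rw [← map_mul, ← map_smul]
  congr 1
  -- The constants cancel: `(1 / 2π) (2π I) (-I) = 1`.
  have hsl : slice D.I (2 * Real.pi * Complex.I) = (2 * Real.pi) • D.I := by
    rw [← sliceHom_apply D.I_mem]
    have : (2 * Real.pi * Complex.I : ℂ) = (2 * Real.pi : ℝ) • Complex.I := by
      rw [Complex.real_smul]; push_cast; ring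
    rw [this, map_smul, sliceHom_I]
  rw [hsl, smul_mul_assoc, smul_smul, ← mul_assoc D.I, mul_neg,
    mul_self_of_mem_imagSphere D.I_mem,
    neg_neg, one_mul, one_div, inv_mul_cancel₀ Real.two_pi_pos.ne', one_smul]

end SliceDomain

/-! ### The functional calculus as a power series in `T` -/

variable [CompleteSpace V] {T : BoundedOp V} {f g : ℍ[ℝ] → ℍ[ℝ]} {a b : ℕ → ℍ[ℝ]} {R : ℝ}

/-- A closed subset of an open ball in the finite-dimensional space `ℍ` lies in a strictly smaller
concentric ball, whose disk in any slice serves as `U`. -/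
theorem exists_encloses (hR : 0 < R) (hT : sSpectrum T ⊆ Metric.ball 0 R) :
    ∃ D : SliceDomain, D.Encloses T ∧
      ∀ z ∈ closure D.U, slice D.I z ∈ Metric.ball (0 : ℍ[ℝ]) R := by
  obtain ⟨ρ, hρ, hTρ⟩ := exists_pos_lt_subset_ball hR (isClosed_sSpectrum T) hT
  obtain ⟨I, hI, -⟩ := exists_slice_eq 0
  refine ⟨diskDomain hI hρ.1, fun z hz => ?_, fun z hz => ?_⟩
  · have := hTρ hz
    rw [mem_ball_zero_iff] at this
    change ‖slice I z‖ < ρ at this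
    rw [norm_slice hI] at this
    exact mem_ball_zero_iff.2 this
  · change z ∈ closure (Metric.ball 0 ρ) at hz
    rw [closure_ball _ hρ.1.ne', mem_closedBall_zero_iff] at hz
    rw [mem_ball_zero_iff]
    change ‖slice I z‖ < R
    rw [norm_slice hI]
    exact hz.trans_lt hρ.2

theorem summable_norm_pow_mul_leftMul (hR : 0 < R) (hT : sSpectrum T ⊆ Metric.ball 0 R)
    (hf : HasRegularSeries f a R) : Summable fun m => ‖T ^ m * leftMul (a m)‖ := by
  obtain ⟨D, hD, hDR⟩ := exists_encloses hR hT
  exact hD.summable_norm hR hDR hf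

theorem exists_admissible (hf : f ∈ locallyRegular T) : ∃ D : SliceDomain, D.Admissible T f := by
  obtain ⟨R, hR, hT, hfR⟩ := hf
  obtain ⟨D, hD, hDR⟩ := exists_encloses hR hT
  exact ⟨D, hD, R, hR, hT, hfR, hDR⟩

theorem cauchyIntegral_eq_tsum (hR : 0 < R) (hf : HasRegularSeries f a R) {D : SliceDomain}
    (hD : D.Admissible T f) : D.cauchyIntegral T f = ∑' m, T ^ m * leftMul (a m) := by
  obtain ⟨hDT, R', hR', hT, hfR', hDR⟩ := hD
  obtain ⟨b, hb⟩ := hfR'.exists_series hR'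
  -- The ball that makes `D` admissible may differ from the given one; the coefficients do not.
  rw [hf.unique hb hR hR']
  exact (SliceDomain.Encloses.hasSum_cauchyIntegral hDT hR' hDR hb).tsum_eq.symm

theorem funCalc_eq_tsum (hfT : f ∈ locallyRegular T) (hR : 0 < R)
    (hf : HasRegularSeries f a R) : funCalc T f = ∑' m, T ^ m * leftMul (a m) := by
  have h := exists_admissible hfT
  rw [funCalc, dif_pos h]
  exact cauchyIntegral_eq_tsum hR hf h.choose_spec

theorem exists_series_of_mem_locallyRegular (hf : f ∈ locallyRegular T) :
    ∃ (a : ℕ → ℍ[ℝ]) (R : ℝ), 0 < R ∧ sSpectrum T ⊆ Metric.ball 0 R ∧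
      LeftRegularOn f (Metric.ball 0 R) ∧ HasRegularSeries f a R := by
  obtain ⟨R, hR, hT, hfR⟩ := hf
  obtain ⟨a, ha⟩ := hfR.exists_series hR
  exact ⟨a, R, hR, hT, hfR, ha⟩

theorem subset_ball_min {s : Set ℍ[ℝ]} {R R' : ℝ} (h : s ⊆ Metric.ball 0 R)
    (h' : s ⊆ Metric.ball 0 R') : s ⊆ Metric.ball 0 (min R R') := fun x hx => by
  have h1 := h hx
  have h2 := h' hx
  rw [mem_ball_zero_iff] at *
  exact lt_min h1 h2

theorem funCalc_add (hf : f ∈ locallyRegular T) (hg : g ∈ locallyRegular T) :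
    f + g ∈ locallyRegular T ∧ funCalc T (f + g) = funCalc T f + funCalc T g := by
  obtain ⟨a, R, hR, hT, hfR, ha⟩ := exists_series_of_mem_locallyRegular hf
  obtain ⟨b, R', hR', hT', hgR, hb⟩ := exists_series_of_mem_locallyRegular hg
  have hmin := lt_min hR hR'
  have hfg : f + g ∈ locallyRegular T := ⟨min R R', hmin, subset_ball_min hT hT',
    (hfR.mono (Metric.ball_subset_ball (min_le_left _ _))).add Metric.isOpen_ball
      (hgR.mono (Metric.ball_subset_ball (min_le_right _ _)))⟩
  refine ⟨hfg, ?_⟩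
  rw [funCalc_eq_tsum hfg hmin ((ha.mono (min_le_left _ _)).add (hb.mono (min_le_right _ _))),
    funCalc_eq_tsum hf hR ha, funCalc_eq_tsum hg hR' hb,
    ← (summable_norm_pow_mul_leftMul hR hT ha).of_norm.tsum_add
      (summable_norm_pow_mul_leftMul hR' hT' hb).of_norm]
  refine tsum_congr fun m => ?_
  rw [← mul_add, Pi.add_apply]
  exact congrArg _ ((leftMulHom V).map_add _ _)

theorem funCalc_mul_const (hf : f ∈ locallyRegular T) (c : ℍ[ℝ]) :
    (fun s => f s * c) ∈ locallyRegular T ∧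
      funCalc T (fun s => f s * c) = funCalc T f * leftMul c := by
  obtain ⟨a, R, hR, hT, hfR, ha⟩ := exists_series_of_mem_locallyRegular hf
  have hfc : (fun s => f s * c) ∈ locallyRegular T :=
    ⟨R, hR, hT, hfR.mul_const Metric.isOpen_ball c⟩
  refine ⟨hfc, ?_⟩
  rw [funCalc_eq_tsum hfc hR (ha.mul_const c), funCalc_eq_tsum hf hR ha,
    ← (summable_norm_pow_mul_leftMul hR hT ha).of_norm.tsum_mul_right]
  refine tsum_congr fun m => ?_
  rw [mul_assoc]
  exact congrArg _ ((leftMulHom V).map_mul _ _)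

/-- With real coefficients every term of the series at a point of `L_I` commutes with `I`. This is
what makes the product with another regular function regular. -/
theorem slice_commute_of_hasRegularSeries {a : ℕ → ℝ}
    (ha : HasRegularSeries f (fun n => (a n : ℍ[ℝ])) R) {I : ℍ[ℝ]} (hI : I ∈ imagSphere) {z : ℂ}
    (hz : slice I z ∈ Metric.ball (0 : ℍ[ℝ]) R) :
    I * f (slice I z) = f (slice I z) * I := by
  have h := ha _ hz
  refine (h.mul_left I).unique ?_
  refine (congrArg (fun u => HasSum u _) (funext fun n => ?_)).mp (h.mul_right I)
  have hc : slice I z ^ n * I = I * slice I z ^ n := by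
    rw [← sliceHom_apply hI, ← map_pow, sliceHom_mul_comm]
  rw [mul_assoc, Quaternion.coe_commutes, ← mul_assoc, hc, mul_assoc]

theorem funCalc_mul (hf : f ∈ locallyRegular T) (hg : g ∈ locallyRegular T)
    (hfs : IsRealPowerSeriesNear T f) (hgs : IsRealPowerSeriesNear T g) :
    f * g ∈ locallyRegular T ∧ funCalc T (f * g) = funCalc T f * funCalc T g := by
  obtain ⟨a, R₁, hR₁, hT₁, ha⟩ := hfs
  obtain ⟨b, R₂, hR₂, hT₂, hb⟩ := hgs
  obtain ⟨R₃, hR₃, hT₃, hfR⟩ := id hf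
  obtain ⟨R₄, hR₄, hT₄, hgR⟩ := id hg
  -- The balls of the given real expansions and those of regularity are unrelated, so all four are
  -- intersected.
  set R := min (min R₁ R₂) (min R₃ R₄)
  have hR : 0 < R := lt_min (lt_min hR₁ hR₂) (lt_min hR₃ hR₄)
  have hT : sSpectrum T ⊆ Metric.ball 0 R :=
    subset_ball_min (subset_ball_min hT₁ hT₂) (subset_ball_min hT₃ hT₄)
  have ha' : HasRegularSeries f (fun n => (a n : ℍ[ℝ])) R :=
    HasRegularSeries.mono ha ((min_le_left _ _).trans (min_le_left _ _))
  have hb' : HasRegularSeries g (fun n => (b n : ℍ[ℝ])) R :=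
    HasRegularSeries.mono hb ((min_le_left _ _).trans (min_le_right _ _))
  have hfg : f * g ∈ locallyRegular T := ⟨R, hR, hT,
    (hfR.mono (Metric.ball_subset_ball ((min_le_right _ _).trans (min_le_left _ _)))).mul
      Metric.isOpen_ball
      (hgR.mono (Metric.ball_subset_ball ((min_le_right _ _).trans (min_le_right _ _))))
      fun I hI z hz => slice_commute_of_hasRegularSeries ha' hI hz⟩
  refine ⟨hfg, ?_⟩
  rw [funCalc_eq_tsum hfg hR (HasRegularSeries.mul a b ha' hb'), funCalc_eq_tsum hf hR ha',
    funCalc_eq_tsum hg hR hb', tsum_mul_tsum_eq_tsum_sum_range_of_summable_norm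
      (summable_norm_pow_mul_leftMul hR hT ha') (summable_norm_pow_mul_leftMul hR hT hb')]
  have hreal : ∀ r : ℝ, (leftMul (r : ℍ[ℝ]) : BoundedOp V) = algebraMap ℝ _ r :=
    (leftMulHom V).commutes
  refine tsum_congr fun m => ?_
  rw [hreal, map_sum, Finset.mul_sum]
  refine Finset.sum_congr rfl fun k hk => ?_
  rw [hreal, hreal, map_mul, mul_assoc, ← mul_assoc (algebraMap ℝ (BoundedOp V) (a k)),
    Algebra.commutes (a k) (T ^ (m - k)), mul_assoc, ← mul_assoc (T ^ k), ← pow_add,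
    Nat.add_sub_cancel' (Nat.lt_succ_iff.1 (Finset.mem_range.1 hk))]

end Operators

end QuaternionicCalculus

end

open QuaternionicCalculus
theorem theorem5 {V : Type*} [NormedAddCommGroup V] [NormedSpace ℝ V] [CompleteSpace V]
    [Module ℍ[ℝ] V] [IsBoundedSMul ℍ[ℝ] V] [IsScalarTower ℝ ℍ[ℝ] V]
    [Module ℍ[ℝ]ᵐᵒᵖ V] [IsBoundedSMul ℍ[ℝ]ᵐᵒᵖ V] [IsScalarTower ℝ ℍ[ℝ]ᵐᵒᵖ V]
    [SMulCommClass ℍ[ℝ] ℍ[ℝ]ᵐᵒᵖ V] (T : BoundedOp V) :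
    (∀ f ∈ locallyRegular T, (∃ D : SliceDomain, D.Admissible T f) ∧
      ∀ D : SliceDomain, D.Admissible T f → D.cauchyIntegral T f = funCalc T f) ∧
    (∀ f ∈ locallyRegular T, ∀ g ∈ locallyRegular T,
      f + g ∈ locallyRegular T ∧ funCalc T (f + g) = funCalc T f + funCalc T g) ∧
    (∀ f ∈ locallyRegular T, ∀ c : ℍ[ℝ],
      (fun s => f s * c) ∈ locallyRegular T ∧
        funCalc T (fun s => f s * c) = funCalc T f * leftMul c) ∧
    (∀ φ ∈ locallyRegular T, ∀ ψ ∈ locallyRegular T,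
      IsRealPowerSeriesNear T φ → IsRealPowerSeriesNear T ψ →
        φ * ψ ∈ locallyRegular T ∧ funCalc T (φ * ψ) = funCalc T φ * funCalc T ψ) := by
  refine ⟨fun f hf => ⟨exists_admissible hf, fun D hD => ?_⟩,
    fun f hf g hg => funCalc_add hf hg, fun f hf c => funCalc_mul_const hf c,
    fun φ hφ ψ hψ hφs hψs => funCalc_mul hφ hψ hφs hψs⟩
  obtain ⟨a, R, hR, -, -, ha⟩ := exists_series_of_mem_locallyRegular hf
  rw [cauchyIntegral_eq_tsum hR ha hD, funCalc_eq_tsum hf hR ha]
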